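/- A digraph $T=(V,E)$ is \emph{semi-complete} if it is finite, has no loops and no parallel arcs, and any two distinct vertices are joined by at least one arc (possibly by two opposite ones). A \emph{path decomposition} of $T$ is a sequence $W_1,\dots,W_r$ ($r\ge 1$) of subsets of $V$ (bags) such that $\bigcup_i W_i=V$; $W_i\cap W_l\subseteq W_j$ for $i<j<l$; and for every arc $(u,v)\in E$ either $u,v\in W_i$ for some $i$, or $u\in W_i$, $v\in W_j$ for some $i>j$. Its \emph{width} is $\max_i|W_i|-1$. A \emph{separation of order $j$} of $T$ is a pair $(A,B)$ of sets with $A\cup B=V$, $|A\cap B|\le j$ and no arc from $A\setminus B$ to $B\setminus A$. A set $Z\subseteq V$ is a \emph{$k$-jungle} if $|Z|=k$ and there are no $x,y\in Z$ and no separation $(A,B)$ of order smaller than $k$ with $x\in A\setminus B$ and $y\in B\setminus A$. \textbf{Theorem.} There is an algorithm that, given a semi-complete digraph $T=(V,E)$ and an integer $k\ge 0$, runs in time $2^{O(k\log k)}\,|V|^3\log|V|$ and outputs (1) either a path decomposition of $T$ of width at most $4k^2+7k$, (2) or a $k$-jungle of $T$. Here an algorithm is a single program for a unit-cost word RAM,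 with words of $O(\log(|V|+k))$ bits, that gets $T$ as an adjacency matrix and lists the bags, or the jungle, explicitly. The time bound means that there is a constant $C$ such that the number of steps is at most $C\,2^{C k\log k}\,|V|^3\log|V|$ for all $T$ and $k$ (with $0\log 0=0$, and with $|V|$ replaced by $\max(|V|,2)$ in the bound). -/

import Mathlib

/-! ### Semi-complete digraphs, path decompositions, jungles -/

namespace SemicompletePathwidth

/-- A digraph is semi-complete if it has no loops and any two distinct vertices are joined by at
least one arc. (A `Digraph` has at most one arc from `u` to `v`, so there are no parallel arcs;
opposite arcs are allowed.) -/
def IsSemicomplete {V : Type*} (T : Digraph V) : Prop :=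
  (∀ v, ¬ T.Adj v v) ∧ ∀ u v, u ≠ v → T.Adj u v ∨ T.Adj v u

/-- `W 0, …, W (r - 1)` is a path decomposition of the digraph `T`: a nonempty sequence of bags
that cover the vertices, every vertex occurs in an interval of bags, and every arc either lies in
a bag or goes from a vertex of a later bag to a vertex of an earlier bag. -/
structure IsPathDecomposition {V : Type*} [DecidableEq V] (T : Digraph V) {r : ℕ}
    (W : Fin r → Finset V) : Prop where
  nonempty : 0 < r
  cover : ∀ v, ∃ i, v ∈ W i
  interval : ∀ i j l, i < j → j < l → W i ∩ W l ⊆ W j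
  arc : ∀ u v, T.Adj u v →
    (∃ i, u ∈ W i ∧ v ∈ W i) ∨ ∃ i j, j < i ∧ u ∈ W i ∧ v ∈ W j

/-- The width of a sequence of bags: the maximum size of a bag, minus one. -/
def width {V : Type*} {r : ℕ} (W : Fin r → Finset V) : ℤ :=
  ((Finset.univ.sup fun i => (W i).card : ℕ) : ℤ) - 1

/-- `(A, B)` is a separation of order `j` of the digraph `T`. -/
structure IsSeparation {V : Type*} [Fintype V] [DecidableEq V] (T : Digraph V)
    (A B : Finset V) (j : ℕ) : Prop where
  cover : A ∪ B = Finset.univ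
  order : (A ∩ B).card ≤ j
  no_arc : ∀ u ∈ A \ B, ∀ v ∈ B \ A, ¬ T.Adj u v

/-- `Z` is a `k`-jungle of `T`: it has `k` elements, and no `y ∈ Z` can be separated from an
`x ∈ Z` by a separation of order smaller than `k`. -/
def IsJungle {V : Type*} [Fintype V] [DecidableEq V] (T : Digraph V) (k : ℕ)
    (Z : Finset V) : Prop :=
  Z.card = k ∧ ∀ x ∈ Z, ∀ y ∈ Z,
    ¬ ∃ (j : ℕ) (A B : Finset V), j < k ∧ IsSeparation T A B j ∧ x ∈ A \ B ∧ y ∈ B \ A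

/-! ### A word RAM with unit-cost steps -/

/-- The binary word operations. Comparisons return `1` (true) or `0` (false), subtraction is
truncated, and division and remainder follow the conventions of `ℕ` for the divisor `0`. -/
inductive BinOp
  | add | sub | mul | div | mod | eq | lt

/-- The value of a binary operation. -/
def BinOp.eval : BinOp → ℕ → ℕ → ℕ
  | .add, a, b => a + b
  | .sub, a, b => a - b
  | .mul, a, b => a * b
  | .div, a, b => a / b
  | .mod, a, b => a % b
  | .eq, a, b => if a = b then 1 else 0
  | .lt, a, b => if a < b then 1 else 0

/-- A state of the machine: the contents of the registers and of the random access memory.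
(A program is a finite object and mentions only finitely many registers.) -/
structure State where
  reg : ℕ → ℕ
  mem : ℕ → ℕ

/-- Programs of the machine. `i`, `j`, `l` are names of registers. -/
inductive Prog
  /-- do nothing -/
  | skip
  /-- `reg i := a` -/
  | const (i a : ℕ)
  /-- `reg i := o (reg j) (reg l)` -/
  | op (o : BinOp) (i j l : ℕ)
  /-- `reg i := mem (reg j)` -/
  | load (i j : ℕ)
  /-- `mem (reg i) := reg j` -/
  | store (i j : ℕ)
  /-- first `p`, then `q` -/
  | seq (p q : Prog)
  /-- if `reg i ≠ 0` then `p` else `q` -/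
  | ite (i : ℕ) (p q : Prog)
  /-- while `reg i ≠ 0` do `p` -/
  | loop (i : ℕ) (p : Prog)

/-- `Exec M P s s' t`: started in the state `s`, the program `P` halts in the state `s'` after
exactly `t` steps, and every word that it writes is smaller than `M` (a program that would have to
write a larger word has no execution). Every elementary instruction and every evaluation of the
test of a conditional or of a loop is one step. -/
inductive Exec (M : ℕ) : Prog → State → State → ℕ → Prop
  | skip (s : State) : Exec M .skip s s 1
  | const (i a : ℕ) (s : State) (h : a < M) :
      Exec M (.const i a) s { s with reg := Function.update s.reg i a } 1
  | op (o : BinOp) (i j l : ℕ) (s : State) (h : o.eval (s.reg j) (s.reg l) < M) :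
      Exec M (.op o i j l) s
        { s with reg := Function.update s.reg i (o.eval (s.reg j) (s.reg l)) } 1
  | load (i j : ℕ) (s : State) (h : s.mem (s.reg j) < M) :
      Exec M (.load i j) s { s with reg := Function.update s.reg i (s.mem (s.reg j)) } 1
  | store (i j : ℕ) (s : State) (h : s.reg j < M) :
      Exec M (.store i j) s { s with mem := Function.update s.mem (s.reg i) (s.reg j) } 1
  | seq (p q : Prog) (s s₁ s₂ : State) (t₁ t₂ : ℕ) (h₁ : Exec M p s s₁ t₁)
      (h₂ : Exec M q s₁ s₂ t₂) : Exec M (.seq p q) s s₂ (t₁ + t₂)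
  | ite_true (i : ℕ) (p q : Prog) (s s₁ : State) (t : ℕ) (h : s.reg i ≠ 0)
      (h₁ : Exec M p s s₁ t) : Exec M (.ite i p q) s s₁ (t + 1)
  | ite_false (i : ℕ) (p q : Prog) (s s₁ : State) (t : ℕ) (h : s.reg i = 0)
      (h₁ : Exec M q s s₁ t) : Exec M (.ite i p q) s s₁ (t + 1)
  | loop_step (i : ℕ) (p : Prog) (s s₁ s₂ : State) (t₁ t₂ : ℕ) (h : s.reg i ≠ 0)
      (h₁ : Exec M p s s₁ t₁) (h₂ : Exec M (.loop i p) s₁ s₂ t₂) :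
      Exec M (.loop i p) s s₂ (t₁ + t₂ + 1)
  | loop_exit (i : ℕ) (p : Prog) (s : State) (h : s.reg i = 0) : Exec M (.loop i p) s s 1

/-! ### Input and output of the algorithm -/

open Classical in
/-- The initial state for a digraph with vertices `0, …, n - 1` and a parameter `k`: the numbers
`n` and `k` are in the registers `0` and `1`, the adjacency matrix is in the memory cells
`0, …, n * n - 1`, row by row, and everything else is `0`. -/
noncomputable def inputState {n : ℕ} (T : Digraph (Fin n)) (k : ℕ) : State where
  reg := fun i => if i = 0 then n else if i = 1 then k else 0
  mem := fun a => if ∃ u v : Fin n, a = (u : ℕ) * n + (v : ℕ) ∧ T.Adj u v then 1 else 0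

/-- The memory lists the set `S` at the address `p`: first the number of elements of `S`, then
these elements, each of them once, in any order. -/
def ListsSet {n : ℕ} (mem : ℕ → ℕ) (p : ℕ) (S : Finset (Fin n)) : Prop :=
  mem p = S.card ∧ ∀ v : Fin n, v ∈ S ↔ ∃ i < S.card, mem (p + 1 + i) = (v : ℕ)

/-- The state `s` outputs the set `Z`: register `0` holds `1` and register `1` holds the address
of a list of the elements of `Z`. -/
def OutputsSet {n : ℕ} (s : State) (Z : Finset (Fin n)) : Prop :=
  s.reg 0 = 1 ∧ ListsSet s.mem (s.reg 1) Z

/-- The state `s` outputs the sequence of bags `W`: register `0` holds `0`, register `1` holds the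
number `r` of bags, and the `r` memory cells from the address in register `2` on hold the
addresses of lists of the elements of the bags. -/
def OutputsBags {n r : ℕ} (s : State) (W : Fin r → Finset (Fin n)) : Prop :=
  s.reg 0 = 0 ∧ s.reg 1 = r ∧
    ∀ i : Fin r, ListsSet s.mem (s.mem (s.reg 2 + (i : ℕ))) (W i)

end SemicompletePathwidth

/-! Order the vertices by out-degree. An arc from a higher to a lower rank is harmless for a path
decomposition whose bags sweep through the ranks from below. Only arcs from a lower to a much higher
rank force both ends into a common bag. "Linked from `x` to `y`" means that no separation of order
less than `k` has `x` strictly on its first and `y` strictly on its second side; a jungle is a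
`k`-set of mutually linked vertices.

If `11k - 13` consecutive ranks have out-degrees that differ by less than `k`, then the vertices of
in-degree at least `5k - 6` inside this window are linked from every vertex of the window
(`linked_of_indeg`), and there are at least `k` of them (`le_card_large_indeg`), so any `k` of them
are a jungle. If there is no such window, the out-degree jumps by `k` within every `gap = 11k - 13`
ranks, so a vertex is linked to all vertices at least `gap` ranks below it
(`linked_of_outdeg_add_le`, `linked_of_rk`).

In the second case consider, for each `i`, the cut between the ranks below `i` and the ranks from `i
+ w` on, where `w = 2 gap + k`. The bag of the cut has the vertices in between and a greedy vertex
cover of the arcs from low to high: a high vertex with at least `k` low in-neighbours, and the low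
in-neighbours of a high vertex with at most `k` of them. These bags always form a path decomposition
(`isPathDecomposition_bag`). If one exceeds the size limit, the `k` middle vertices of its window
are a jungle: they are linked to all low vertices and from all high ones, so a separation of order
less than `k` between two of them would have the low side in `A` and the high side in `B`. Then `A ∩
B` would cover all arcs from low to high with fewer than `k` vertices, and the greedy cover would
have at most `(k - 1)(k + 1)` elements (`card_cover_le`, `linked_of_card_bag`).

Everything is computed by iterated sums, in time `O(n ^ 3)` independently of `k`. The machine part
compiles a small expression language with bounded sums once and for all (`Arith.exec_code`); words
stay polynomial in `n + k + 2`, and the exponent of the running time is the nesting depth of sums.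
The algorithm is a sequence of array fills and assignments, each verified through its `Achieves`
triple. -/

namespace SemicompletePathwidth

/-! ### Degrees inside a set of vertices -/

section Degrees

variable {V : Type*} [DecidableEq V] {T : Digraph V} [DecidableRel T.Adj]

/-- If the in-degrees inside a set of vertices are at most `d`, it has at most `2 d + 1`
elements. -/
theorem card_le_of_indeg_le (hT : IsSemicomplete T) (W : Finset V) (d : ℕ)
    (h : ∀ y ∈ W, (W.filter fun x => T.Adj x y).card ≤ d) : W.card ≤ 2 * d + 1 := by
  have hsum : ∑ y ∈ W, (W.filter fun x => T.Adj x y).card ≤ W.card * d := by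
    simpa using Finset.sum_le_card_nsmul W _ d h
  -- Both sums count the arcs inside `W`. Since each vertex is joined to the other `|W| - 1`, this
  -- yields `|W| (|W| - 1) ≤ 2 d |W|`.
  have hswap : ∑ y ∈ W, (W.filter fun x => T.Adj y x).card =
      ∑ y ∈ W, (W.filter fun x => T.Adj x y).card := by
    simp only [Finset.card_filter]
    exact Finset.sum_comm
  have hpair : ∀ y ∈ W, W.card ≤
      1 + ((W.filter fun x => T.Adj x y).card + (W.filter fun x => T.Adj y x).card) := by
    intro y _
    have hsub : W ⊆ {y} ∪ ((W.filter fun x => T.Adj x y) ∪ (W.filter fun x => T.Adj y x)) := by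
      intro x hx
      by_cases hxy : x = y
      · simp [hxy]
      · rcases hT.2 x y hxy with h1 | h1 <;> simp [hx, h1]
    have h1 := Finset.card_le_card hsub
    have h2 := Finset.card_union_le {y}
      ((W.filter fun x => T.Adj x y) ∪ (W.filter fun x => T.Adj y x))
    have h3 := Finset.card_union_le (W.filter fun x => T.Adj x y) (W.filter fun x => T.Adj y x)
    simp only [Finset.card_singleton] at h2
    omega
  have htot := Finset.sum_le_sum hpair
  rw [Finset.sum_add_distrib, Finset.sum_add_distrib, hswap] at htot
  simp only [Finset.sum_const, smul_eq_mul, mul_one] at htot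
  by_contra hlt
  push Not at hlt
  have : W.card * (2 * d + 2) ≤ W.card * W.card := Nat.mul_le_mul_left _ hlt
  have hpos : 0 < W.card := by omega
  nlinarith

/-- The same for out-degrees. -/
theorem card_le_of_outdeg_le (hT : IsSemicomplete T) (W : Finset V) (d : ℕ)
    (h : ∀ y ∈ W, (W.filter fun x => T.Adj y x).card ≤ d) : W.card ≤ 2 * d + 1 := by
  let R : Digraph V := ⟨fun u v => T.Adj v u⟩
  have : DecidableRel R.Adj := fun u v => inferInstanceAs (Decidable (T.Adj v u))
  have hR : IsSemicomplete R := ⟨hT.1, fun u v huv => (hT.2 u v huv).symm⟩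
  refine card_le_of_indeg_le hR W d fun y hy => ?_
  convert h y hy using 2
  ext x
  simp [R]

/-- The remaining vertices have in-degree at most `5k - 7` among themselves, so there are at most `2
(5k - 7) + 1 = 10k - 13` of them. This is the origin of the window length `11k - 13`. -/
theorem le_card_large_indeg (hT : IsSemicomplete T) {k : ℕ} (hk : 2 ≤ k) {X : Finset V}
    (hX : 11 * k - 13 ≤ X.card) :
    k ≤ (X.filter fun y => 5 * k ≤ (X.filter fun u => T.Adj u y).card + 6).card := by
  set W := X.filter fun y => ¬ 5 * k ≤ (X.filter fun u => T.Adj u y).card + 6 with hW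
  have hin : ∀ y ∈ W, (W.filter fun x => T.Adj x y).card ≤ 5 * k - 7 := by
    intro y hy
    have h1 := (Finset.mem_filter.1 hy).2
    have h2 : (W.filter fun x => T.Adj x y) ⊆ X.filter fun x => T.Adj x y :=
      Finset.filter_subset_filter _ (Finset.filter_subset _ _)
    have := Finset.card_le_card h2
    omega
  have h1 := card_le_of_indeg_le hT W _ hin
  have h2 : (X.filter fun y => 5 * k ≤ (X.filter fun u => T.Adj u y).card + 6).card + W.card =
      X.card := by
    rw [hW]
    convert Finset.card_filter_add_card_filter_not (s := X)
      (fun y => 5 * k ≤ (X.filter fun u => T.Adj u y).card + 6)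
  omega

end Degrees

/-! ### Linked vertices -/

section Linked

variable {V : Type*} [Fintype V] [DecidableEq V]

/-- No separation of order smaller than `k` has `x` on its first and `y` on its second side. -/
def Linked (T : Digraph V) (k : ℕ) (x y : V) : Prop :=
  ¬ ∃ (j : ℕ) (A B : Finset V), j < k ∧ IsSeparation T A B j ∧ x ∈ A \ B ∧ y ∈ B \ A

/-- The out-degree of a vertex. -/
def outdeg (T : Digraph V) [DecidableRel T.Adj] (v : V) : ℕ :=
  (Finset.univ.filter fun u => T.Adj v u).card

variable {T : Digraph V}

theorem IsSeparation.mem_left {A B : Finset V} {j : ℕ} (h : IsSeparation T A B j) {u v : V}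
    (hu : u ∈ A \ B) (huv : T.Adj u v) : v ∈ A := by
  by_contra hv
  have : v ∈ A ∪ B := by rw [h.cover]; exact Finset.mem_univ v
  exact h.no_arc u hu v (by grind) huv

theorem IsSeparation.mem_right {A B : Finset V} {j : ℕ} (h : IsSeparation T A B j) {u v : V}
    (hv : v ∈ B \ A) (huv : T.Adj u v) : u ∈ B := by
  by_contra hu
  have : u ∈ A ∪ B := by rw [h.cover]; exact Finset.mem_univ u
  exact h.no_arc u (by grind) v hv huv

variable [DecidableRel T.Adj]

/-- Given a separation, the out-neighbours of `x` lie in `A`; those outside `B` have no arc to `y`,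
hence are out-neighbours of `y`. So the out-degrees differ by at most the order. -/
theorem linked_of_outdeg_add_le (hT : IsSemicomplete T) {k : ℕ} {x y : V}
    (h : outdeg T y + k ≤ outdeg T x) : Linked T k x y := by
  rintro ⟨j, A, B, hj, hs, hx, hy⟩
  have hsub : (Finset.univ.filter fun u => T.Adj x u) ⊆
      (A ∩ B) ∪ (Finset.univ.filter fun u => T.Adj y u) := by
    intro w hw
    have hxw : T.Adj x w := by simpa using hw
    have hwA := hs.mem_left hx hxw
    by_cases hwB : w ∈ B
    · simp [hwA, hwB]
    · have hne : w ≠ y := by rintro rfl; exact hwB (by grind)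
      have h1 : ¬ T.Adj w y := hs.no_arc w (by grind) y hy
      have h2 := (hT.2 w y hne).resolve_left h1
      simp [h2]
  have h1 := Finset.card_le_card hsub
  have h2 := Finset.card_union_le (A ∩ B) (Finset.univ.filter fun u => T.Adj y u)
  have h3 := hs.order
  unfold outdeg at h
  omega

/-- In a set of vertices of nearly equal out-degrees, every vertex is linked to the vertices that
have many in-neighbours in the set. -/
theorem linked_of_indeg (hT : IsSemicomplete T) {k : ℕ} (hk : 2 ≤ k) {X : Finset V}
    (hX : ∀ u ∈ X, ∀ v ∈ X, outdeg T v < outdeg T u + k) {x y : V} (hx : x ∈ X) (hy : y ∈ X)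
    (hdeg : 5 * k ≤ (X.filter fun u => T.Adj u y).card + 6) : Linked T k x y := by
  rintro ⟨j, A, B, hj, hs, hxA, hyB⟩
  have horder := hs.order
  have hA : (A \ B).card + (A ∩ B).card = A.card := Finset.card_sdiff_add_card_inter A B
  -- The vertex `x` and all its out-neighbours lie in `A`.
  have hdx : outdeg T x + 1 ≤ A.card := by
    have hsub : insert x (Finset.univ.filter fun u => T.Adj x u) ⊆ A := by
      intro w hw
      rcases Finset.mem_insert.1 hw with rfl | hw
      · grind
      · exact hs.mem_left hxA (by simpa using hw)
    have := Finset.card_le_card hsub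
    rwa [Finset.card_insert_of_notMem (by simpa using hT.1 x)] at this
  set Y := X.filter (fun v => v ∈ B \ A) with hYdef
  -- A vertex `z` of `Y` has arcs to all of `A \ B`, so its out-degree inside `Y` is at most `outdeg
  -- z - |A \ B|`, which is at most `outdeg x + (k - 1) - |A \ B| ≤ |A ∩ B| + k - 2`.
  have hout : ∀ z ∈ Y, (Y.filter fun v => T.Adj z v).card ≤ 2 * k - 3 := by
    intro z hz
    have hzX : z ∈ X := (Finset.mem_filter.1 hz).1
    have hzB : z ∈ B \ A := (Finset.mem_filter.1 hz).2
    have hsub : (A \ B) ∪ (Y.filter fun v => T.Adj z v) ⊆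
        Finset.univ.filter fun u => T.Adj z u := by
      intro w hw
      rcases Finset.mem_union.1 hw with hw | hw
      · have h1 := hs.no_arc w hw z hzB
        have hne : w ≠ z := by rintro rfl; grind
        simpa using (hT.2 w z hne).resolve_left h1
      · simpa using (Finset.mem_filter.1 hw).2
    have hdisj : Disjoint (A \ B) (Y.filter fun v => T.Adj z v) := by
      rw [Finset.disjoint_left]
      intro w hw hw'
      have := (Finset.mem_filter.1 (Finset.mem_filter.1 hw').1).2
      grind
    have h1 := Finset.card_le_card hsub
    rw [Finset.card_union_of_disjoint hdisj] at h1
    have h2 := hX x hx z hzX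
    unfold outdeg at h2 hdx
    omega
  have hYcard := card_le_of_outdeg_le hT Y _ hout
  have hyY : y ∈ Y := Finset.mem_filter.2 ⟨hy, hyB⟩
  -- In-neighbours of `y` lie in `B`. There are at most `(4k - 5) - 1` of them in `Y` and at most `k
  -- - 1` in `A ∩ B`, together fewer than `5k - 6`.
  have hsub : (X.filter fun u => T.Adj u y) ⊆ Y.erase y ∪ (A ∩ B) := by
    intro u hu
    obtain ⟨huX, huy⟩ := Finset.mem_filter.1 hu
    have huB := hs.mem_right hyB huy
    have hne : u ≠ y := by rintro rfl; exact hT.1 _ huy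
    by_cases huA : u ∈ A
    · simp [huA, huB]
    · simp [hYdef, huA, huB, huX, hne]
  have h1 := Finset.card_le_card hsub
  have h2 := Finset.card_union_le (Y.erase y) (A ∩ B)
  rw [Finset.card_erase_of_mem hyY] at h2
  omega

/-- If some pair between `X` and `Y` is not linked although everything that leads from it to `X`
and from `Y` to it is, then the arcs from `X` to `Y` have a small vertex cover, which bounds the
number of vertices that are forced into a cover or are joined to a vertex of small in-degree. -/
theorem card_cover_le {k : ℕ} {X Y : Finset V} {z z' : V}
    (hX : ∀ u ∈ X, Linked T k z u) (hY : ∀ v ∈ Y, Linked T k v z') (h : ¬ Linked T k z z')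
    {U : Finset V} (hU : ∀ v ∈ U, (v ∈ Y ∧ k ≤ (X.filter fun u => T.Adj u v).card) ∨
      (v ∈ X ∧ ∃ v' ∈ Y, T.Adj v v' ∧ (X.filter fun u => T.Adj u v').card ≤ k)) :
    U.card + (k + 1) ≤ (k + 1) * k := by
  unfold Linked at h
  push Not at h
  obtain ⟨j, A, B, hj, hs, hz, hz'⟩ := h
  have horder := hs.order
  have hmem : ∀ v, v ∈ A ∨ v ∈ B := fun v => by
    have : v ∈ A ∪ B := by rw [hs.cover]; exact Finset.mem_univ v
    simpa using this
  have hXA : ∀ u ∈ X, u ∈ A := fun u hu => by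
    by_contra hA
    have := hmem u
    exact hX u hu ⟨j, A, B, hj, hs, hz, by grind⟩
  have hYB : ∀ u ∈ Y, u ∈ B := fun u hu => by
    by_contra hB
    have := hmem u
    exact hY u hu ⟨j, A, B, hj, hs, by grind, hz'⟩
  have hcov : ∀ u ∈ X, ∀ v ∈ Y, T.Adj u v → u ∈ A ∩ B ∨ v ∈ A ∩ B := by
    intro u hu v hv huv
    by_contra hcon
    push Not at hcon
    have h1 := hXA u hu
    have h2 := hYB v hv
    exact hs.no_arc u (by grind) v (by grind) huv
  set S := A ∩ B with hS
  -- A vertex with `k` in-neighbours in `X` must be in the cover `S`, since otherwise all these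
  -- in-neighbours are. A vertex of the second kind is in `S`, or its partner `v'` is, and then it
  -- is among the at most `k` in-neighbours of `v'`. Hence `|U| ≤ (k + 1) |S|`.
  have hsub : U ⊆ S ∪ (S.filter fun v => (X.filter fun u => T.Adj u v).card ≤ k).biUnion
      fun v => X.filter fun u => T.Adj u v := by
    intro v hv
    rcases hU v hv with ⟨hvY, hc⟩ | ⟨hvX, v', hv'Y, hadj, hc⟩
    · by_cases hvS : v ∈ S
      · exact Finset.mem_union_left _ hvS
      · have : (X.filter fun u => T.Adj u v) ⊆ S := fun u hu => by
          obtain ⟨h1, h2⟩ := Finset.mem_filter.1 hu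
          exact (hcov u h1 v hvY h2).resolve_right hvS
        have := Finset.card_le_card this
        omega
    · rcases hcov v hvX v' hv'Y hadj with h1 | h1
      · exact Finset.mem_union_left _ h1
      · refine Finset.mem_union_right _ (Finset.mem_biUnion.2 ⟨v', ?_, ?_⟩)
        · exact Finset.mem_filter.2 ⟨h1, hc⟩
        · exact Finset.mem_filter.2 ⟨hvX, hadj⟩
  have h1 := Finset.card_le_card hsub
  have h2 := Finset.card_union_le S ((S.filter fun v => (X.filter fun u => T.Adj u v).card ≤ k).biUnion
      fun v => X.filter fun u => T.Adj u v)
  have h3 := Finset.card_biUnion_le_card_mul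
    (S.filter fun v => (X.filter fun u => T.Adj u v).card ≤ k)
    (fun v => X.filter fun u => T.Adj u v) k (fun v hv => (Finset.mem_filter.1 hv).2)
  have h4 := Finset.card_filter_le S (fun v => (X.filter fun u => T.Adj u v).card ≤ k)
  have h5 : U.card ≤ S.card * (k + 1) := by nlinarith
  have h6 : (S.card + 1) * (k + 1) ≤ k * (k + 1) := Nat.mul_le_mul_right _ (by omega)
  nlinarith

end Linked

/-! ### Ranks -/

section Rank

variable {n : ℕ}

/-- The number of elements that precede `v` in the order by the key `f`, with ties broken by the
index. -/
def rank (f : Fin n → ℕ) (v : Fin n) : ℕ :=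
  (Finset.univ.filter fun u => f u < f v ∨ (f u = f v ∧ u < v)).card

theorem rank_lt_rank {f : Fin n → ℕ} {u v : Fin n} (h : f u < f v ∨ (f u = f v ∧ u < v)) :
    rank f u < rank f v := by
  refine Finset.card_lt_card ⟨fun w hw => ?_, fun hsub => ?_⟩
  · simp only [Finset.mem_filter, Finset.mem_univ, true_and] at hw ⊢
    omega
  · have := @hsub u (by simpa using h)
    simp at this

theorem rank_injective (f : Fin n → ℕ) : Function.Injective (rank f) := by
  intro u v h
  by_contra hne
  have : (f u < f v ∨ (f u = f v ∧ u < v)) ∨ (f v < f u ∨ (f v = f u ∧ v < u)) := by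
    have : (u : ℕ) ≠ v := fun h => hne (Fin.ext h)
    omega
  rcases this with h1 | h1 <;> have := rank_lt_rank h1 <;> omega

theorem rank_lt (f : Fin n → ℕ) (v : Fin n) : rank f v < n := by
  have : (Finset.univ.filter fun u => f u < f v ∨ (f u = f v ∧ u < v)) ⊂ Finset.univ := by
    refine ⟨Finset.subset_univ _, fun h => ?_⟩
    have := h (Finset.mem_univ v)
    simp at this
  simpa [rank] using Finset.card_lt_card this

theorem le_of_rank_le {f : Fin n → ℕ} {u v : Fin n} (h : rank f u ≤ rank f v) : f u ≤ f v := by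
  by_contra hlt
  have := rank_lt_rank (f := f) (u := v) (v := u) (Or.inl (by omega))
  omega

theorem exists_rank_eq (f : Fin n → ℕ) {i : ℕ} (hi : i < n) : ∃ v, rank f v = i := by
  let g : Fin n → Fin n := fun v => ⟨rank f v, rank_lt f v⟩
  have hg : Function.Injective g := fun u v h => rank_injective f (by simpa [g] using h)
  obtain ⟨v, hv⟩ := (Finite.injective_iff_surjective.1 hg) ⟨i, hi⟩
  exact ⟨v, by simpa [g] using congrArg Fin.val hv⟩

theorem card_rank_window (f : Fin n → ℕ) {i l : ℕ} (h : i + l ≤ n) :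
    (Finset.univ.filter fun v => i ≤ rank f v ∧ rank f v < i + l).card = l := by
  have : (Finset.univ.filter fun v => i ≤ rank f v ∧ rank f v < i + l).image (rank f) =
      Finset.Ico i (i + l) := by
    ext p
    simp only [Finset.mem_image, Finset.mem_filter, Finset.mem_univ, true_and, Finset.mem_Ico]
    constructor
    · rintro ⟨v, hv, rfl⟩; exact hv
    · intro hp
      obtain ⟨v, hv⟩ := exists_rank_eq f (i := p) (by omega)
      exact ⟨v, by omega, hv⟩
  rw [← Finset.card_image_of_injective _ (rank_injective f), this]
  simp

end Rank

/-! ### The bags -/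

section Bags

variable {n : ℕ} (T : Digraph (Fin n)) [DecidableRel T.Adj] (rk : Fin n → ℕ) (w k : ℕ)

/-- The number of in-neighbours of `v` whose rank is less than `i`. -/
def lowIndeg (i : ℕ) (v : Fin n) : ℕ :=
  (Finset.univ.filter fun u => rk u < i ∧ T.Adj u v).card

/-- The bag for the cut between the ranks less than `i` and the ranks at least `i + w`. -/
def bag (i : ℕ) : Finset (Fin n) :=
  Finset.univ.filter fun v => (i ≤ rk v ∧ rk v ≤ i + w) ∨
    (i + w ≤ rk v ∧ k ≤ lowIndeg T rk i v) ∨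
    (rk v < i ∧ ∃ v', T.Adj v v' ∧ i + w ≤ rk v' ∧ lowIndeg T rk i v' ≤ k)

variable {T rk}

theorem lowIndeg_mono {i j : ℕ} (h : i ≤ j) (v : Fin n) :
    lowIndeg T rk i v ≤ lowIndeg T rk j v := by
  refine Finset.card_le_card fun u hu => ?_
  simp only [Finset.mem_filter, Finset.mem_univ, true_and] at hu ⊢
  exact ⟨by omega, hu.2⟩

theorem lowIndeg_succ_le (hrk : Function.Injective rk) (i : ℕ) (v : Fin n) :
    lowIndeg T rk (i + 1) v ≤ lowIndeg T rk i v + 1 := by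
  have hsub : (Finset.univ.filter fun u => rk u < i + 1 ∧ T.Adj u v) ⊆
      (Finset.univ.filter fun u => rk u < i ∧ T.Adj u v) ∪
      (Finset.univ.filter fun u => rk u = i) := by
    intro u hu
    simp only [Finset.mem_filter, Finset.mem_univ, true_and, Finset.mem_union] at hu ⊢
    by_cases h : rk u = i
    · exact Or.inr h
    · exact Or.inl ⟨by omega, hu.2⟩
  have h1 := Finset.card_le_card hsub
  have h2 := Finset.card_union_le (Finset.univ.filter fun u => rk u < i ∧ T.Adj u v)
    (Finset.univ.filter fun u => rk u = i)
  have h3 : (Finset.univ.filter fun u => rk u = i).card ≤ 1 :=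
    Finset.card_le_one.2 fun a ha b hb => hrk (by simp at ha hb; omega)
  unfold lowIndeg
  omega

-- Moving the cut upwards one rank at a time raises the low in-degree of a fixed vertex by at most
-- one, so it cannot skip the value `k`. The two greedy rules overlap exactly at `k`, which puts
-- both ends of a long forward arc into one bag.
variable (T) in
theorem isPathDecomposition_bag (hrk : Function.Injective rk) (hlt : ∀ v, rk v < n) (hw : w < n) :
    IsPathDecomposition T fun i : Fin (n - w) => bag T rk w k i := by
  have hwin : ∀ (i : ℕ) v, i ≤ rk v → rk v ≤ i + w → v ∈ bag T rk w k i := fun i v h1 h2 => by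
    simp [bag, h1, h2]
  refine ⟨by omega, fun v => ?_, fun i j l hij hjl => ?_, fun u v huv => ?_⟩
  · have := hlt v
    -- There are only `n - w` cuts, and the window of the last one reaches the top rank `n - 1`.
    exact ⟨⟨min (rk v) (n - w - 1), by omega⟩, hwin _ _ (by simp) (by simp; omega)⟩
  · intro v hv
    rw [Finset.mem_inter] at hv
    obtain ⟨hvi, hvl⟩ := hv
    simp only [bag, Finset.mem_filter, Finset.mem_univ, true_and] at hvi hvl ⊢
    have hij' : (i : ℕ) < j := hij
    have hjl' : (j : ℕ) < l := hjl
    -- By monotonicity, the rule for high vertices persists when the cut moves up (from `i` to `j`),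
    -- and the rule for low vertices when it moves down (from `l` to `j`).
    have hm := lowIndeg_mono (T := T) (rk := rk) hij'.le v
    by_cases h1 : rk v < j
    · right; right
      refine ⟨h1, ?_⟩
      obtain ⟨v', hv', h2, h3⟩ := (hvl.resolve_left (by omega)).resolve_left (by omega) |>.2
      exact ⟨v', hv', by omega, (lowIndeg_mono hjl'.le v').trans h3⟩
    · by_cases h2 : rk v ≤ j + w
      · left; omega
      · right; left
        have := (hvi.resolve_left (by omega)).resolve_right (by omega)
        omega
  · have hu := hlt u
    have hv := hlt v
    -- Arcs that do not increase the rank: the windows of the two ends give a later and an earlier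
    -- bag, or the same bag.
    by_cases hle : rk v ≤ rk u
    · rcases Nat.lt_or_ge (min (rk v) (n - w - 1)) (min (rk u) (n - w - 1)) with h | h
      · right
        refine ⟨⟨min (rk u) (n - w - 1), by omega⟩, ⟨min (rk v) (n - w - 1), by omega⟩, ?_,
          hwin _ _ (by simp) (by simp; omega), hwin _ _ (by simp) (by simp; omega)⟩
        exact h
      · left
        refine ⟨⟨min (rk v) (n - w - 1), by omega⟩, hwin _ _ ?_ ?_, hwin _ _ ?_ ?_⟩ <;>
          simp only <;> omega
    left
    push Not at hle
    by_cases hnear : rk v ≤ rk u + w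
    · refine ⟨⟨min (rk u) (n - w - 1), by omega⟩, hwin _ _ ?_ ?_, hwin _ _ ?_ ?_⟩ <;>
        simp only <;> omega
    push Not at hnear
    have hkey : ∃ i, rk u ≤ i ∧ i + w ≤ rk v ∧ u ∈ bag T rk w k i ∧ v ∈ bag T rk w k i := by
      have hucut : ∀ i, rk u < i → i + w ≤ rk v → lowIndeg T rk i v ≤ k → u ∈ bag T rk w k i :=
        fun i h1 h2 h3 => by
          simp only [bag, Finset.mem_filter, Finset.mem_univ, true_and]
          exact Or.inr (Or.inr ⟨h1, v, huv, h2, h3⟩)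
      have hvcut : ∀ i, i + w ≤ rk v → k ≤ lowIndeg T rk i v → v ∈ bag T rk w k i :=
        fun i h1 h2 => by
          simp only [bag, Finset.mem_filter, Finset.mem_univ, true_and]
          exact Or.inr (Or.inl ⟨h1, h2⟩)
      -- Take the first admissible cut at which `v` has at least `k` low in-neighbours. If it is at
      -- `rk u`, then `u` is in the window; otherwise `v` has exactly `k` there, and both rules
      -- apply.
      by_cases hex : ∃ i, rk u ≤ i ∧ i + w ≤ rk v ∧ k ≤ lowIndeg T rk i v
      · classical
        obtain ⟨h1, h2, h3⟩ := Nat.find_spec hex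
        have hmin := fun {m} => Nat.find_min (H := hex) (m := m)
        set i := Nat.find hex
        rcases Nat.eq_or_lt_of_le h1 with h4 | h4
        · exact ⟨i, h1, h2, hwin _ _ (by omega) (by omega), hvcut i h2 h3⟩
        · have h5 := hmin (m := i - 1) (by omega)
          have h6 := lowIndeg_succ_le (T := T) hrk (i - 1) v
          rw [Nat.sub_add_cancel (by omega)] at h6
          have h7 : lowIndeg T rk (i - 1) v < k := by
            by_contra h
            exact h5 ⟨by omega, by omega, by omega⟩
          exact ⟨i, h1, h2, hucut i h4 h2 (by omega), hvcut i h2 h3⟩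
      -- If the value `k` is never reached, use the last admissible cut: there `v` is the top of the
      -- window, and `u` enters by the rule for low vertices.
      · push Not at hex
        have h1 := hex (rk v - w) (by omega) (by omega)
        exact ⟨rk v - w, by omega, by omega, hucut _ (by omega) (by omega) h1.le,
          hwin _ _ (by omega) (by omega)⟩
    obtain ⟨i, h1, h2, h3, h4⟩ := hkey
    exact ⟨⟨i, by omega⟩, h3, h4⟩

theorem card_window_le (hrk : Function.Injective rk) (i : ℕ) :
    (Finset.univ.filter fun v => i ≤ rk v ∧ rk v ≤ i + w).card ≤ w + 1 := by
  rw [← Finset.card_image_of_injective _ hrk]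
  have : (Finset.univ.filter fun v => i ≤ rk v ∧ rk v ≤ i + w).image rk ⊆
      Finset.Icc i (i + w) := by
    intro p hp
    simp only [Finset.mem_image, Finset.mem_filter, Finset.mem_univ, true_and] at hp
    obtain ⟨v, hv, rfl⟩ := hp
    simpa using hv
  have := Finset.card_le_card this
  simp only [Nat.card_Icc] at this
  omega

/-- If a bag is large, then all vertices between the two sides of the cut that are linked to the
first and from the second are linked to each other. -/
theorem linked_of_card_bag (hrk : Function.Injective rk) {i : ℕ} {z z' : Fin n}
    (hz : ∀ u, rk u < i → Linked T k z u) (hz' : ∀ v, i + w ≤ rk v → Linked T k v z')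
    (hcard : w + 1 + (k + 1) * k < (bag T rk w k i).card + (k + 1)) : Linked T k z z' := by
  by_contra hcon
  -- Outside the window, which has at most `w + 1` vertices, the bag consists of the vertices
  -- counted by `card_cover_le`.
  set U := (bag T rk w k i).filter fun v => ¬ (i ≤ rk v ∧ rk v ≤ i + w) with hU
  have hfil : ∀ v, ((Finset.univ.filter fun u => rk u < i).filter fun u => T.Adj u v).card =
      lowIndeg T rk i v := fun v => by
    rw [Finset.filter_filter]; rfl
  have h1 := card_cover_le (T := T) (k := k) (X := Finset.univ.filter fun u => rk u < i)
    (Y := Finset.univ.filter fun v => i + w ≤ rk v) (z := z) (z' := z')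
    (fun u hu => hz u (by simpa using hu)) (fun v hv => hz' v (by simpa using hv)) hcon
    (U := U) (fun v hv => by
      rw [hU, Finset.mem_filter] at hv
      obtain ⟨hv, hne⟩ := hv
      simp only [bag, Finset.mem_filter, Finset.mem_univ, true_and] at hv
      rcases hv.resolve_left hne with ⟨h1, h2⟩ | ⟨h1, v', h2, h3, h4⟩
      · left
        rw [hfil]
        exact ⟨by simpa using h1, h2⟩
      · right
        refine ⟨by simpa using h1, v', by simpa using h3, h2, ?_⟩
        rw [hfil]
        exact h4)
  have h2 : ((bag T rk w k i).filter fun v => i ≤ rk v ∧ rk v ≤ i + w).card + U.card =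
      (bag T rk w k i).card := by
    rw [hU]
    convert Finset.card_filter_add_card_filter_not (s := bag T rk w k i)
      (fun v => i ≤ rk v ∧ rk v ≤ i + w)
  have h3 := Finset.card_le_card (Finset.filter_subset_filter
    (fun v => i ≤ rk v ∧ rk v ≤ i + w) (Finset.subset_univ (bag T rk w k i)))
  have h4 := card_window_le w hrk i
  omega

end Bags

/-! ### Counted loops -/

/-- Assigning a value to a register. -/
def State.setReg (s : State) (i a : ℕ) : State := { s with reg := Function.update s.reg i a }

/-- Assigning a value to a memory cell. -/
def State.setMem (s : State) (i a : ℕ) : State := { s with mem := Function.update s.mem i a }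

@[simp] theorem State.setReg_mem (s : State) (i a : ℕ) : (s.setReg i a).mem = s.mem := (rfl)

@[simp] theorem State.setMem_reg (s : State) (i a : ℕ) : (s.setMem i a).reg = s.reg := (rfl)

theorem State.setReg_reg (s : State) (i a j : ℕ) :
    (s.setReg i a).reg j = if j = i then a else s.reg j := Function.update_apply _ _ _ _

theorem State.setMem_mem (s : State) (i a j : ℕ) :
    (s.setMem i a).mem j = if j = i then a else s.mem j := Function.update_apply _ _ _ _

/-- For `x = 0, …, n - 1` do `body`, where `n` is the value of register `0`; the register `f` is
used for the test of the loop. -/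
def forLoop (x f : ℕ) (body : Prog) : Prog :=
  .seq (.const x 0) (.seq (.op .lt f x 0)
    (.loop f (.seq body (.seq (.const f 1) (.seq (.op .add x x f) (.op .lt f x 0))))))

/-- `I j` is the invariant before round `j`; by `hI` it must not depend on the two loop registers.
Each round has an overhead of four steps (three instructions and the test); the final `3` is for the
two initial instructions and the last test. -/
theorem exec_forLoop {M x f n T : ℕ} {body : Prog} {I : ℕ → State → Prop}
    (hM : n < M) (hM1 : 1 < M) (hx : x ≠ 0) (hf : f ≠ 0) (hfx : f ≠ x)
    (hI : ∀ j s s', I j s → s'.mem = s.mem → (∀ r, r ≠ x → r ≠ f → s'.reg r = s.reg r) → I j s')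
    (hn : ∀ j s, I j s → s.reg 0 = n)
    (hbody : ∀ j s, j < n → I j s → s.reg x = j →
      ∃ s' t, Exec M body s s' t ∧ I (j + 1) s' ∧ s'.reg x = j ∧ t ≤ T)
    {s : State} (hs : I 0 s) :
    ∃ s' t, Exec M (forLoop x f body) s s' t ∧ I n s' ∧ t ≤ n * (T + 4) + 3 := by
  have hlt : ∀ s : State, BinOp.lt.eval (s.reg x) (s.reg 0) < M := fun s => by
    simp only [BinOp.eval]; split_ifs <;> omega
  -- Induction on the number `m` of rounds that remain.
  have key : ∀ m j s, j + m = n → I j s → s.reg x = j → s.reg f = (if j < n then 1 else 0) →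
      ∃ s' t, Exec M (.loop f (.seq body (.seq (.const f 1) (.seq (.op .add x x f)
        (.op .lt f x 0))))) s s' t ∧ I n s' ∧ t ≤ m * (T + 4) + 1 := by
    intro m
    induction m with
    | zero =>
      intro j s hj hIs hxs hfs
      have hj' : j = n := by omega
      subst hj'
      exact ⟨s, 1, .loop_exit _ _ _ (by simpa using hfs), hIs, by omega⟩
    | succ m ih =>
      intro j s hj hIs hxs hfs
      obtain ⟨s₁, t₁, he, hI₁, hx₁, ht₁⟩ := hbody j s (by omega) hIs hxs
      have h0 := hn _ _ hI₁
      set s₂ := s₁.setReg f 1 with hs₂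
      set s₃ := s₂.setReg x (BinOp.add.eval (s₂.reg x) (s₂.reg f)) with hs₃
      set s₄ := s₃.setReg f (BinOp.lt.eval (s₃.reg x) (s₃.reg 0)) with hs₄
      have hx₃ : s₃.reg x = j + 1 := by
        simp [hs₃, hs₂, State.setReg_reg, BinOp.eval, Ne.symm hfx, hx₁]
      have h0₃ : s₃.reg 0 = n := by
        simp [hs₃, hs₂, State.setReg_reg, Ne.symm hx, Ne.symm hf, h0]
      have hx₄ : s₄.reg x = j + 1 := by
        rw [hs₄, State.setReg_reg, if_neg (Ne.symm hfx), hx₃]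
      have hf₄ : s₄.reg f = if j + 1 < n then 1 else 0 := by
        rw [hs₄, State.setReg_reg, if_pos rfl, hx₃, h0₃]; rfl
      have hI₄ : I (j + 1) s₄ := by
        refine hI _ _ _ hI₁ rfl fun r hr hr' => ?_
        simp [hs₄, hs₃, hs₂, State.setReg_reg, hr, hr']
      obtain ⟨s', t', he', hI', ht'⟩ := ih (j + 1) s₄ (by omega) hI₄ hx₄ hf₄
      refine ⟨s', (t₁ + (1 + (1 + 1))) + t' + 1, .loop_step _ _ s s₄ s' _ _ ?_ ?_ he', hI', ?_⟩
      · rw [hfs, if_pos (by omega)]; omega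
      · refine .seq _ _ _ _ _ _ _ he (.seq _ _ _ s₂ _ _ _ (.const _ _ _ hM1)
          (.seq _ _ _ s₃ _ _ _ (.op _ _ _ _ _ ?_) (.op _ _ _ _ _ (hlt s₃))))
        have : BinOp.add.eval (s₂.reg x) (s₂.reg f) = j + 1 := by
          rw [hs₃, State.setReg_reg, if_pos rfl] at hx₃
          exact hx₃
        rw [this]; omega
      · rw [Nat.succ_mul]; omega
  set s₁ := s.setReg x 0 with hs₁
  set s₂ := s₁.setReg f (BinOp.lt.eval (s₁.reg x) (s₁.reg 0)) with hs₂
  have hI₂ : I 0 s₂ := hI _ _ _ hs rfl fun r hr hr' => by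
    simp [hs₂, hs₁, State.setReg_reg, hr, hr']
  obtain ⟨s', t, he, hI', ht⟩ := key n 0 s₂ (by omega) hI₂
    (by simp [hs₂, hs₁, State.setReg_reg, Ne.symm hfx])
    (by simp [hs₂, hs₁, State.setReg_reg, Ne.symm hx, hn _ _ hs, BinOp.eval])
  exact ⟨s', 1 + (1 + t), .seq _ _ _ s₁ _ _ _ (.const _ _ _ (by omega))
    (.seq _ _ _ s₂ _ _ _ (.op _ _ _ _ _ (hlt s₁)) he), hI', by omega⟩

/-! ### Expressions -/

/-- Expressions: `sum x e` is the sum of the values of `e` for `x = 0, …, n - 1`, where `n` is the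
value of register `0` and `x` is a register. -/
inductive Arith
  | lit (a : ℕ)
  | var (i : ℕ)
  | bin (o : BinOp) (e f : Arith)
  | ld (e : Arith)
  | cond (c e f : Arith)
  | sum (x : ℕ) (e : Arith)

namespace Arith

/-- The value of an expression. -/
def eval : Arith → State → ℕ
  | lit a, _ => a
  | var i, s => s.reg i
  | bin o e f, s => o.eval (e.eval s) (f.eval s)
  | ld e, s => s.mem (e.eval s)
  | cond c e f, s => if c.eval s ≠ 0 then e.eval s else f.eval s
  | sum x e, s => ∑ j ∈ Finset.range (s.reg 0), e.eval (s.setReg x j)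

/-- The free variables are less than `l`, and nested sums use the variables `l, l + 1, …`. -/
def WF : Arith → ℕ → Prop
  | lit _, _ => True
  | var i, l => i < l
  | bin _ e f, l => e.WF l ∧ f.WF l
  | ld e, l => e.WF l
  | cond c e f, l => c.WF l ∧ e.WF l ∧ f.WF l
  | sum x e, l => x = l ∧ l < 40 ∧ e.WF (l + 1)

/-- The nesting depth of sums. -/
def depth : Arith → ℕ
  | lit _ => 0
  | var _ => 0
  | bin _ e f => max e.depth f.depth
  | ld e => e.depth
  | cond c e f => max c.depth (max e.depth f.depth)
  | sum _ e => e.depth + 1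

/-- A program that writes the value of an expression to register `d`, with the registers greater
than `d` and the variables of sums as scratch space. -/
def code : Arith → ℕ → Prog
  | lit a, d => .const d a
  | var i, d => .seq (.const d 0) (.op .add d i d)
  | bin o e f, d => .seq (e.code d) (.seq (f.code (d + 1)) (.op o d d (d + 1)))
  | ld e, d => .seq (e.code d) (.load d d)
  | cond c e f, d => .seq (c.code d) (.ite d (e.code d) (f.code d))
  | sum x e, d => .seq (.const d 0)
      (forLoop x (d + 1) (.seq (e.code (d + 2)) (.op .add d d (d + 2))))

/-- Scratch registers do not influence values. The condition `1 ≤ l` protects register `0`, which is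
the range of every sum. -/
theorem eval_congr {e : Arith} : ∀ {l : ℕ}, e.WF l → 1 ≤ l → ∀ {s s' : State},
    s'.mem = s.mem → (∀ i < l, s'.reg i = s.reg i) → e.eval s' = e.eval s := by
  induction e with
  | lit a => intros; rfl
  | var i => intro l h _ s s' _ hr; exact hr i h
  | bin o e f ihe ihf =>
    intro l h hl s s' hm hr
    simp only [eval, ihe h.1 hl hm hr, ihf h.2 hl hm hr]
  | ld e ih =>
    intro l h hl s s' hm hr
    simp only [eval, ih h hl hm hr, hm]
  | cond c e f ihc ihe ihf =>
    intro l h hl s s' hm hr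
    simp only [eval, ihc h.1 hl hm hr, ihe h.2.1 hl hm hr, ihf h.2.2 hl hm hr]
  | sum x e ih =>
    intro l h hl s s' hm hr
    simp only [eval, hr 0 hl]
    refine Finset.sum_congr rfl fun j _ => ih h.2.2 (by omega) hm fun i hi => ?_
    have := h.1
    simp only [State.setReg_reg]
    split_ifs with h1
    · rfl
    · exact hr i (by omega)

end Arith

/-- One bound for all operations: `X Y` for products, and `X + Y ≤ 2 X Y` for the rest. With powers
of `b` as `X` and `Y` it is again a power of `b`. -/
theorem BinOp.eval_le (o : BinOp) {x y X Y b : ℕ} (hb : 2 ≤ b) (hx : x ≤ X) (hy : y ≤ Y)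
    (hX : 1 ≤ X) (hY : 1 ≤ Y) : o.eval x y ≤ X * Y * b := by
  have h1 : X ≤ X * Y := Nat.le_mul_of_pos_right _ hY
  have h2 : Y ≤ X * Y := Nat.le_mul_of_pos_left _ hX
  have h3 : X * Y * 2 ≤ X * Y * b := Nat.mul_le_mul_left _ hb
  have h4 : x * y ≤ X * Y := Nat.mul_le_mul hx hy
  have h5 := Nat.div_le_self x y
  have h6 := Nat.mod_le x y
  cases o <;> simp only [BinOp.eval]
  all_goals try split_ifs
  all_goals omega

/-- The registers less than `l` and the memory cells contain numbers at most `B`. -/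
def State.Bdd (l B : ℕ) (s : State) : Prop := (∀ i < l, s.reg i ≤ B) ∧ ∀ a, s.mem a ≤ B

theorem State.Bdd.congr {l B : ℕ} {s s' : State} (h : s.Bdd l B) (hm : s'.mem = s.mem)
    (hr : ∀ i < l, s'.reg i = s.reg i) : s'.Bdd l B :=
  ⟨fun i hi => by rw [hr i hi]; exact h.1 i hi, fun a => by rw [hm]; exact h.2 a⟩

/-- What it means to run the code of an expression in the state `s` with words less than `M`. -/
def Arith.Runs (e : Arith) (l d M T : ℕ) (s : State) : Prop :=
  ∃ s' t, Exec M (e.code d) s s' t ∧ s'.reg d = e.eval s ∧ s'.mem = s.mem ∧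
    (∀ i, i < l ∨ (40 ≤ i ∧ i < d) → s'.reg i = s.reg i) ∧ t ≤ T

/-- The code of a fixed expression writes only words that are polynomial in the words that it
reads, and its running time is polynomial in `n` with an exponent given by the nesting of sums. -/
theorem Arith.exec_code (e : Arith) : ∀ p : ℕ, ∃ c C, ∀ l d b s, e.WF l → 1 ≤ l → l ≤ 40 → 40 ≤ d →
    2 ≤ b → s.reg 0 ≤ b → s.Bdd l (b ^ p) → e.eval s ≤ b ^ c ∧
      ∀ M, b ^ c < M → e.Runs l d M (C * (s.reg 0 + 1) ^ e.depth) s := by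
  have hone : ∀ {b c : ℕ}, 2 ≤ b → 1 ≤ b ^ c := fun h => Nat.one_le_pow _ _ (by omega)
  have hpow : ∀ {b c c' : ℕ}, 2 ≤ b → c ≤ c' → b ^ c ≤ b ^ c' := fun h h' =>
    Nat.pow_le_pow_right (by omega) h'
  have hmul : ∀ {C C' N d d' : ℕ}, C ≤ C' → d ≤ d' → C * (N + 1) ^ d ≤ C' * (N + 1) ^ d' :=
    fun h h' => Nat.mul_le_mul h (Nat.pow_le_pow_right (by omega) h')
  have hpos : ∀ N d : ℕ, 1 ≤ (N + 1) ^ d := fun N d => Nat.one_le_pow _ _ (by omega)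
  induction e with
  | lit a =>
    intro p
    refine ⟨a, 1, fun l d b s _ hl hl' hd hb hn hs => ?_⟩
    have ha : a ≤ b ^ a := (Nat.lt_two_pow_self).le.trans (Nat.pow_le_pow_left hb a)
    refine ⟨ha, fun M hM => ⟨s.setReg d a, 1, .const _ _ _ (by omega), ?_, rfl, ?_, ?_⟩⟩
    · simp [State.setReg_reg, eval]
    · intro i hi; rw [State.setReg_reg, if_neg (by omega)]
    · simp [depth]
  | var i =>
    intro p
    refine ⟨p, 2, fun l d b s h hl hl' hd hb hn hs => ?_⟩
    have h' : i < l := h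
    have hi := hs.1 i h
    refine ⟨hi, fun M hM => ⟨(s.setReg d 0).setReg d (s.reg i), 2, ?_, ?_, rfl, ?_, ?_⟩⟩
    · have hv : BinOp.add.eval ((s.setReg d 0).reg i) ((s.setReg d 0).reg d) = s.reg i := by
        simp only [BinOp.eval, State.setReg_reg]
        rw [if_neg (by omega)]; simp
      have h2 := Exec.op (M := M) .add d i d (s.setReg d 0) (by rw [hv]; omega)
      rw [hv] at h2
      exact .seq _ _ _ _ _ 1 1 (.const _ _ _ (by omega)) h2
    · simp [State.setReg_reg, eval]
    · intro r hr; simp only [State.setReg_reg]; rw [if_neg (by omega), if_neg (by omega)]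
    · simp [depth]
  | bin o e f ihe ihf =>
    intro p
    obtain ⟨c₁, C₁, h₁⟩ := ihe p
    obtain ⟨c₂, C₂, h₂⟩ := ihf p
    refine ⟨c₁ + c₂ + 1, C₁ + C₂ + 1, fun l d b s h hl hl' hd hb hn hs => ?_⟩
    obtain ⟨hv₁, hr₁⟩ := h₁ l d b s h.1 hl hl' hd hb hn hs
    have hv₂ := (h₂ l (d + 1) b s h.2 hl hl' (by omega) hb hn hs).1
    have hv : o.eval (e.eval s) (f.eval s) ≤ b ^ (c₁ + c₂ + 1) := by
      rw [pow_succ, pow_add]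
      exact o.eval_le hb hv₁ hv₂ (hone hb) (hone hb)
    refine ⟨hv, fun M hM => ?_⟩
    obtain ⟨s₁, t₁, he₁, hd₁, hm₁, hg₁, ht₁⟩ := hr₁ M
      ((hpow hb (by omega)).trans_lt hM)
    have hg₁' : ∀ i < l, s₁.reg i = s.reg i := fun i hi => hg₁ i (Or.inl hi)
    obtain ⟨s₂, t₂, he₂, hd₂, hm₂, hg₂, ht₂⟩ := (h₂ l (d + 1) b s₁ h.2 hl hl' (by omega) hb
      (by rw [hg₁' 0 hl]; exact hn) (hs.congr hm₁ hg₁')).2 M ((hpow hb (by omega)).trans_lt hM)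
    rw [hg₁' 0 hl] at ht₂
    rw [eval_congr h.2 hl hm₁ hg₁'] at hd₂
    have hv' : o.eval (s₂.reg d) (s₂.reg (d + 1)) = o.eval (e.eval s) (f.eval s) := by
      rw [hd₂, hg₂ d (Or.inr ⟨hd, by omega⟩), hd₁]
    refine ⟨_, t₁ + (t₂ + 1), .seq _ _ _ _ _ _ _ he₁ (.seq _ _ _ _ _ _ _ he₂
      (.op o d d (d + 1) s₂ (by rw [hv']; omega))), ?_, ?_, ?_, ?_⟩
    · simp [hv', eval]
    · simp [hm₂, hm₁]
    · intro i hi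
      dsimp only
      rw [Function.update_apply, if_neg (by omega), hg₂ i (by omega), hg₁ i (by omega)]
    · have h3 := hmul (N := s.reg 0) (le_refl C₁) (le_max_left e.depth f.depth)
      have h4 := hmul (N := s.reg 0) (le_refl C₂) (le_max_right e.depth f.depth)
      have h5 := hpos (s.reg 0) (max e.depth f.depth)
      simp only [depth, add_mul]
      omega
  | ld e ih =>
    intro p
    obtain ⟨c₁, C₁, h₁⟩ := ih p
    refine ⟨c₁ + p, C₁ + 1, fun l d b s h hl hl' hd hb hn hs => ?_⟩
    obtain ⟨hv₁, hr₁⟩ := h₁ l d b s h hl hl' hd hb hn hs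
    have hv : s.mem (e.eval s) ≤ b ^ (c₁ + p) := (hs.2 _).trans (hpow hb (by omega))
    refine ⟨hv, fun M hM => ?_⟩
    obtain ⟨s₁, t₁, he₁, hd₁, hm₁, hg₁, ht₁⟩ := hr₁ M ((hpow hb (by omega)).trans_lt hM)
    refine ⟨_, t₁ + 1, .seq _ _ _ _ _ _ _ he₁ (.load d d s₁ (by rw [hm₁, hd₁]; omega)),
      ?_, ?_, ?_, ?_⟩
    · simp [hm₁, hd₁, eval]
    · simp [hm₁]
    · intro i hi
      dsimp only
      rw [Function.update_apply, if_neg (by omega), hg₁ i (by omega)]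
    · have h5 := hpos (s.reg 0) e.depth
      simp only [depth, add_mul]
      omega
  | cond c e f ihc ihe ihf =>
    intro p
    obtain ⟨c₀, C₀, h₀⟩ := ihc p
    obtain ⟨c₁, C₁, h₁⟩ := ihe p
    obtain ⟨c₂, C₂, h₂⟩ := ihf p
    refine ⟨c₀ + c₁ + c₂, C₀ + C₁ + C₂ + 1, fun l d b s h hl hl' hd hb hn hs => ?_⟩
    obtain ⟨hv₀, hr₀⟩ := h₀ l d b s h.1 hl hl' hd hb hn hs
    have hv₁ := (h₁ l d b s h.2.1 hl hl' hd hb hn hs).1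
    have hv₂ := (h₂ l d b s h.2.2 hl hl' hd hb hn hs).1
    refine ⟨?_, fun M hM => ?_⟩
    · simp only [eval]
      split_ifs
      · exact hv₁.trans (hpow hb (by omega))
      · exact hv₂.trans (hpow hb (by omega))
    obtain ⟨s₁, t₁, he₁, hd₁, hm₁, hg₁, ht₁⟩ := hr₀ M ((hpow hb (by omega)).trans_lt hM)
    have hg₁' : ∀ i < l, s₁.reg i = s.reg i := fun i hi => hg₁ i (Or.inl hi)
    have h3 := hmul (N := s.reg 0) (le_refl C₀) (le_max_left c.depth (max e.depth f.depth))
    have h4 := hmul (N := s.reg 0) (le_refl C₁)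
      ((le_max_left e.depth f.depth).trans (le_max_right c.depth _))
    have h4' := hmul (N := s.reg 0) (le_refl C₂)
      ((le_max_right e.depth f.depth).trans (le_max_right c.depth _))
    have h5 := hpos (s.reg 0) (max c.depth (max e.depth f.depth))
    by_cases hc : c.eval s = 0
    · obtain ⟨s₂, t₂, he₂, hd₂, hm₂, hg₂, ht₂⟩ := (h₂ l d b s₁ h.2.2 hl hl' hd hb
        (by rw [hg₁' 0 hl]; exact hn) (hs.congr hm₁ hg₁')).2 M ((hpow hb (by omega)).trans_lt hM)
      rw [hg₁' 0 hl] at ht₂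
      rw [eval_congr h.2.2 hl hm₁ hg₁'] at hd₂
      refine ⟨s₂, t₁ + (t₂ + 1), .seq _ _ _ _ _ _ _ he₁
        (.ite_false _ _ _ _ _ _ (by rw [hd₁, hc]) he₂), ?_, ?_, ?_, ?_⟩
      · simp [eval, hc, hd₂]
      · rw [hm₂, hm₁]
      · intro i hi; rw [hg₂ i hi, hg₁ i hi]
      · simp only [depth, add_mul]; omega
    · obtain ⟨s₂, t₂, he₂, hd₂, hm₂, hg₂, ht₂⟩ := (h₁ l d b s₁ h.2.1 hl hl' hd hb
        (by rw [hg₁' 0 hl]; exact hn) (hs.congr hm₁ hg₁')).2 M ((hpow hb (by omega)).trans_lt hM)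
      rw [hg₁' 0 hl] at ht₂
      rw [eval_congr h.2.1 hl hm₁ hg₁'] at hd₂
      refine ⟨s₂, t₁ + (t₂ + 1), .seq _ _ _ _ _ _ _ he₁
        (.ite_true _ _ _ _ _ _ (by rw [hd₁]; exact hc) he₂), ?_, ?_, ?_, ?_⟩
      · simp [eval, hc, hd₂]
      · rw [hm₂, hm₁]
      · intro i hi; rw [hg₂ i hi, hg₁ i hi]
      · simp only [depth, add_mul]; omega
  | sum x e ih =>
    intro p
    -- The summation index is one more register that the inner expression reads. It is less than
    -- `b`, and the exponent `p + 1` covers it even for `p = 0`.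
    obtain ⟨c₁, C₁, h₁⟩ := ih (p + 1)
    refine ⟨c₁ + 1, C₁ + 9, fun l d b s h hl hl' hd hb hn hs => ?_⟩
    obtain ⟨hxl, hl40, hwf⟩ := h
    have hB : ∀ j < s.reg 0, (s.setReg x j).Bdd (l + 1) (b ^ (p + 1)) := fun j hj => by
      refine ⟨fun i hi => ?_, fun a => (hs.2 a).trans (hpow hb (by omega))⟩
      rw [State.setReg_reg]
      split_ifs with h
      · calc j ≤ b := by omega
          _ = b ^ 1 := (pow_one b).symm
          _ ≤ _ := hpow hb (by omega)
      · exact (hs.1 i (by omega)).trans (hpow hb (by omega))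
    have h0 : ∀ j, (s.setReg x j).reg 0 = s.reg 0 := fun j => by
      rw [State.setReg_reg, if_neg (by omega)]
    have hval : ∀ j < s.reg 0, e.eval (s.setReg x j) ≤ b ^ c₁ := fun j hj =>
      (h₁ (l + 1) (d + 2) b _ hwf (by omega) (by omega) (by omega) hb (by rw [h0]; exact hn)
        (hB j hj)).1
    -- The accumulator holds every partial sum, so all of them have to fit into a word.
    have hpart : ∀ m ≤ s.reg 0, ∑ j ∈ Finset.range m, e.eval (s.setReg x j) ≤ b ^ (c₁ + 1) := by
      intro m hm
      calc ∑ j ∈ Finset.range m, e.eval (s.setReg x j)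
          ≤ (Finset.range m).card • b ^ c₁ := Finset.sum_le_card_nsmul _ _ _ fun j hj =>
            hval j (by have := Finset.mem_range.1 hj; omega)
        _ = m * b ^ c₁ := by simp
        _ ≤ b * b ^ c₁ := Nat.mul_le_mul_right _ (hm.trans hn)
        _ = b ^ (c₁ + 1) := (pow_succ' b c₁).symm
    refine ⟨hpart _ le_rfl, fun M hM => ?_⟩
    have hbM : b < M := lt_of_le_of_lt (by simpa using hpow hb (show 1 ≤ c₁ + 1 by omega)) hM
    let I : ℕ → State → Prop := fun j s' => s'.mem = s.mem ∧
      (∀ i, i < l ∨ (40 ≤ i ∧ i < d) → s'.reg i = s.reg i) ∧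
      s'.reg d = ∑ j' ∈ Finset.range j, e.eval (s.setReg x j')
    obtain ⟨s', t, he, hI, ht⟩ := exec_forLoop (M := M) (x := x) (f := d + 1) (n := s.reg 0)
      (T := C₁ * (s.reg 0 + 1) ^ e.depth + 1)
      (body := .seq (e.code (d + 2)) (.op .add d d (d + 2))) (I := I)
      (by omega) (by omega) (by omega) (by omega) (by omega)
      (by
        rintro j s₁ s₂ ⟨hm, hr, hd'⟩ hm' hr'
        refine ⟨by rw [hm', hm], fun i hi => ?_, ?_⟩
        · rw [hr' i (by omega) (by omega), hr i hi]
        · rw [hr' d (by omega) (by omega), hd'])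
      (fun j s₁ h => h.2.1 0 (Or.inl (by omega)))
      (by
        rintro j s₁ hj ⟨hm, hr, hd'⟩ hx₁
        have hag : ∀ i < l + 1, s₁.reg i = (s.setReg x j).reg i := fun i hi => by
          rw [State.setReg_reg]
          split_ifs with h
          · rw [h, hx₁]
          · exact hr i (by omega)
        have h00 : s₁.reg 0 = s.reg 0 := hr 0 (Or.inl hl)
        obtain ⟨s₂, t₂, he₂, hd₂, hm₂, hg₂, ht₂⟩ := (h₁ (l + 1) (d + 2) b s₁ hwf (by omega)
          (by omega) (by omega) hb (by rw [h00]; exact hn) ((hB j hj).congr hm hag)).2 M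
          ((hpow hb (by omega)).trans_lt hM)
        rw [eval_congr hwf (by omega) (show s₁.mem = (s.setReg x j).mem from hm) hag] at hd₂
        have hv : BinOp.add.eval (s₂.reg d) (s₂.reg (d + 2)) =
            ∑ j' ∈ Finset.range (j + 1), e.eval (s.setReg x j') := by
          rw [Finset.sum_range_succ, hd₂, hg₂ d (by omega), hd']; rfl
        refine ⟨_, t₂ + 1, .seq _ _ _ _ _ _ _ he₂ (.op .add d d (d + 2) s₂ ?_), ⟨?_, ?_, ?_⟩,
          ?_, ?_⟩
        · rw [hv]; exact (hpart _ (by omega)).trans_lt hM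
        · simp [hm₂, hm]
        · intro i hi
          dsimp only
          rw [Function.update_apply, if_neg (by omega), hg₂ i (by omega), hr i hi]
        · simp [hv]
        · dsimp only
          rw [Function.update_apply, if_neg (by omega), hg₂ x (by omega), hx₁]
        · rw [h00] at ht₂; omega)
      (s := s.setReg d 0)
      (by
        refine ⟨rfl, fun i hi => ?_, ?_⟩
        · rw [State.setReg_reg, if_neg (by omega)]
        · simp [State.setReg_reg])
    refine ⟨s', 1 + t, .seq _ _ _ _ _ _ _ (.const _ _ _ (by omega)) he, hI.2.2, hI.1, hI.2.1, ?_⟩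
    have h5 := hpos (s.reg 0) e.depth
    simp only [depth, pow_succ]
    set X := (s.reg 0 + 1) ^ e.depth
    nlinarith
/-! ### Programs that fill arrays -/

/-- An input of the algorithm. -/
structure Input where
  n : ℕ
  k : ℕ
  T : Digraph (Fin n)

/-- The number in terms of which words are bounded. -/
def Input.size (i : Input) : ℕ := i.n + i.k + 2

/-- From every state with `pre` the program reaches a state with `post`, in time `O(n ^ 3)` and
with words that are polynomial in the size of the input. -/
def Achieves (P : Prog) (pre post : Input → State → Prop) : Prop :=
  ∀ p, ∃ q c C, ∀ i s, pre i s → s.Bdd 20 (i.size ^ p) → ∀ M, i.size ^ c < M →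
    ∃ s' t, Exec M P s s' t ∧ post i s' ∧ s'.Bdd 20 (i.size ^ q) ∧ t ≤ C * (i.n + 1) ^ 3

theorem Input.two_le_size (i : Input) : 2 ≤ i.size := by unfold Input.size; omega

theorem Input.pow_size_le (i : Input) {c c' : ℕ} (h : c ≤ c') : i.size ^ c ≤ i.size ^ c' :=
  Nat.pow_le_pow_right (by have := i.two_le_size; omega) h

theorem Input.le_pow_size (i : Input) {c : ℕ} (h : 1 ≤ c) : i.size ≤ i.size ^ c := by
  simpa using i.pow_size_le h

/-- The exponent `q` of the bound after `P` serves as the exponent `p` for `Q`; this is why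
`Achieves` quantifies over all `p`. -/
theorem Achieves.seq {P Q : Prog} {pre mid post : Input → State → Prop}
    (hP : Achieves P pre mid) (hQ : Achieves Q mid post) : Achieves (.seq P Q) pre post := by
  intro p
  obtain ⟨q₁, c₁, C₁, h₁⟩ := hP p
  obtain ⟨q₂, c₂, C₂, h₂⟩ := hQ q₁
  refine ⟨q₂, c₁ + c₂, C₁ + C₂, fun i s hs hB M hM => ?_⟩
  obtain ⟨s₁, t₁, he₁, hm, hB₁, ht₁⟩ := h₁ i s hs hB M ((i.pow_size_le (by omega)).trans_lt hM)
  obtain ⟨s₂, t₂, he₂, hp, hB₂, ht₂⟩ := h₂ i s₁ hm hB₁ M ((i.pow_size_le (by omega)).trans_lt hM)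
  exact ⟨s₂, t₁ + t₂, .seq _ _ _ _ _ _ _ he₁ he₂, hp, hB₂, by rw [add_mul]; omega⟩

/-- `reg x := e`. -/
def assign (x : ℕ) (e : Arith) : Prog :=
  .seq (e.code 40) (.seq (.const 41 0) (.op .add x 40 41))

/-- A single evaluation may use three nested sums within cubic time. -/
theorem achieves_assign {x : ℕ} {e : Arith} {pre post : Input → State → Prop}
    (hwf : e.WF 20) (hdep : e.depth ≤ 3) (hn : ∀ i s, pre i s → s.reg 0 = i.n)
    (hpost : ∀ i s s', pre i s → s'.mem = s.mem → s'.reg x = e.eval s →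
      (∀ r < 20, r ≠ x → s'.reg r = s.reg r) → post i s') :
    Achieves (assign x e) pre post := by
  intro p
  obtain ⟨c, C, h⟩ := e.exec_code p
  refine ⟨p + c, c, C + 2, fun i s hs hB M hM => ?_⟩
  have h0 := hn i s hs
  obtain ⟨hv, hr⟩ := h 20 40 i.size s hwf (by omega) (by omega) le_rfl i.two_le_size
    (by rw [h0]; unfold Input.size; omega) hB
  obtain ⟨s₁, t₁, he, hd, hm, hg, ht⟩ := hr M hM
  have hval : BinOp.add.eval ((s₁.setReg 41 0).reg 40) ((s₁.setReg 41 0).reg 41) = e.eval s := by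
    simp [State.setReg_reg, BinOp.eval, hd]
  have hop := Exec.op (M := M) .add x 40 41 (s₁.setReg 41 0) (by rw [hval]; omega)
  rw [hval] at hop
  have hreg : ∀ r < 20, r ≠ x → ((s₁.setReg 41 0).setReg x (e.eval s)).reg r = s.reg r :=
    fun r hr hrx => by
      rw [State.setReg_reg, if_neg hrx, State.setReg_reg, if_neg (by omega), hg r (Or.inl hr)]
  have hregx : ((s₁.setReg 41 0).setReg x (e.eval s)).reg x = e.eval s := by
    rw [State.setReg_reg, if_pos rfl]
  refine ⟨(s₁.setReg 41 0).setReg x (e.eval s), t₁ + (1 + 1),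
    .seq _ _ _ _ _ _ _ he (.seq _ _ _ _ _ _ _ (.const _ _ _ (by omega)) hop),
    hpost i s _ hs hm hregx hreg, ⟨fun r hr => ?_, fun a => ?_⟩, ?_⟩
  · by_cases hrx : r = x
    · rw [hrx, hregx]; exact hv.trans (i.pow_size_le (by omega))
    · rw [hreg r hr hrx]; exact (hB.1 r hr).trans (i.pow_size_le (by omega))
  · rw [State.setReg_mem, State.setReg_mem, hm]
    exact (hB.2 a).trans (i.pow_size_le (by omega))
  · rw [h0] at ht
    have h1 : C * (i.n + 1) ^ e.depth ≤ C * (i.n + 1) ^ 3 :=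
      Nat.mul_le_mul_left _ (Nat.pow_le_pow_right (by omega) hdep)
    have h2 : 1 ≤ (i.n + 1) ^ 3 := Nat.one_le_pow _ _ (by omega)
    rw [add_mul]; omega

/-- For all values less than `n` of the registers `20` and `21`: `mem a := e`. -/
def fill (a e : Arith) : Prog :=
  forLoop 20 40 (forLoop 21 41 (.seq (a.code 42) (.seq (e.code 43) (.store 42 43))))

/-- `σ` is a state of a loop that starts in `s` and writes to the cells `A x y` only. -/
structure InFill (n : ℕ) (A : ℕ → ℕ → ℕ) (s σ : State) (x y : ℕ) : Prop where
  reg : ∀ r < 20, σ.reg r = s.reg r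
  reg_row : σ.reg 20 = x
  reg_col : σ.reg 21 = y
  mem : ∀ c, (∀ x < n, ∀ y < n, c ≠ A x y) → σ.mem c = s.mem c

/-- `s'` is a state that is reached from `s` by writing `F x y` to the cells `A x y`. -/
structure Filled (n : ℕ) (A F : ℕ → ℕ → ℕ) (s s' : State) : Prop where
  reg : ∀ r < 20, s'.reg r = s.reg r
  mem_fill : ∀ x < n, ∀ y < n, s'.mem (A x y) = F x y
  mem : ∀ c, (∀ x < n, ∀ y < n, c ≠ A x y) → s'.mem c = s.mem c

/-- The two loops already cost `n ^ 2` evaluations, so each may contain only one level of sums.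
Values are required in every intermediate state, as the filling must not disturb what the
expressions read; `hcons` permits writing a cell repeatedly. -/
theorem achieves_fill {a e : Arith} {pre post : Input → State → Prop} (A F : Input → ℕ → ℕ → ℕ)
    (hwa : a.WF 22) (hwe : e.WF 22) (hda : a.depth ≤ 1) (hde : e.depth ≤ 1)
    (hn : ∀ i s, pre i s → s.reg 0 = i.n)
    (heval : ∀ i s, pre i s → ∀ x < i.n, ∀ y < i.n, ∀ σ, InFill i.n (A i) s σ x y →
      a.eval σ = A i x y ∧ e.eval σ = F i x y)
    (hcons : ∀ (i : Input), ∀ x < i.n, ∀ y < i.n, ∀ x' < i.n, ∀ y' < i.n, A i x y = A i x' y' →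
      F i x y = F i x' y')
    (hpost : ∀ i s s', pre i s → Filled i.n (A i) (F i) s s' → post i s') :
    Achieves (fill a e) pre post := by
  intro p
  obtain ⟨c₀, C₀, h₀⟩ := e.exec_code (p + 1)
  set p₁ := p + 1 + c₀ with hp₁
  obtain ⟨c₁, C₁, h₁⟩ := a.exec_code p₁
  obtain ⟨c₂, C₂, h₂⟩ := e.exec_code p₁
  refine ⟨p₁, c₁ + c₂ + 1, C₁ + C₂ + 15, fun i s hs hB M hM => ?_⟩
  have h0 := hn i s hs
  have hb := i.two_le_size
  have hnb : i.n < i.size := by unfold Input.size; omega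
  have hbM : i.size < M := (i.le_pow_size (by omega)).trans_lt hM
  -- All written values are bounded beforehand, by evaluating `e` in the initial state with adjusted
  -- indices. A bound derived from the current memory would grow from round to round.
  have hF : ∀ x < i.n, ∀ y < i.n, F i x y ≤ i.size ^ p₁ := by
    intro x hx y hy
    set σ := (s.setReg 20 x).setReg 21 y with hσ
    have hreg : ∀ r, σ.reg r = if r = 21 then y else if r = 20 then x else s.reg r := fun r => by
      rw [hσ, State.setReg_reg, State.setReg_reg]
    have hev := (heval i s hs x hx y hy σ ⟨fun r hr => by rw [hreg, if_neg (by omega),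
      if_neg (by omega)], by simp [hreg], by simp [hreg], fun c _ => rfl⟩).2
    rw [← hev]
    have h00 : σ.reg 0 = i.n := by simp [hreg, h0]
    refine ((h₀ 22 40 i.size σ hwe (by omega) (by omega) le_rfl hb (by omega)
      ⟨fun r hr => ?_, fun c => ?_⟩).1).trans (i.pow_size_le (by omega))
    · have h1 := i.le_pow_size (c := p + 1) (by omega)
      rw [hreg]
      split_ifs
      · omega
      · omega
      · exact (hB.1 r (by omega)).trans (i.pow_size_le (by omega))
    · exact (hB.2 c).trans (i.pow_size_le (by omega))
  let I : ℕ → ℕ → State → Prop := fun x y σ =>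
    (∀ r < 20, σ.reg r = s.reg r) ∧
    (∀ c, (∀ x < i.n, ∀ y < i.n, c ≠ A i x y) → σ.mem c = s.mem c) ∧
    (∀ c, σ.mem c ≤ i.size ^ p₁) ∧
    ∀ x' < i.n, ∀ y' < i.n, (x' < x ∨ (x' = x ∧ y' < y)) → σ.mem (A i x' y') = F i x' y'
  have hIcongr : ∀ {x y σ σ'}, I x y σ → σ'.mem = σ.mem → (∀ r < 20, σ'.reg r = σ.reg r) →
      I x y σ' := fun h hm hr => by
    refine ⟨fun r hr' => by rw [hr r hr', h.1 r hr'], ?_⟩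
    rw [hm]; exact h.2
  obtain ⟨X, hX⟩ : ∃ X, X = i.n + 1 := ⟨_, rfl⟩
  have hin : ∀ x σ, x < i.n → I x 0 σ → σ.reg 20 = x → ∃ σ' t,
      Exec M (forLoop 21 41 (.seq (a.code 42) (.seq (e.code 43) (.store 42 43)))) σ σ' t ∧
      (I x i.n σ' ∧ σ'.reg 20 = x) ∧ t ≤ i.n * ((C₁ + C₂ + 1) * X + 4) + 3 := by
    intro x σ hx hI hσx
    refine exec_forLoop (I := fun y σ => I x y σ ∧ σ.reg 20 = x) (by omega) (by omega) (by omega)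
      (by omega) (by omega) ?_ ?_ ?_ ⟨hI, hσx⟩
    · rintro y σ σ' ⟨h1, h2⟩ hm hr
      exact ⟨hIcongr h1 hm fun r hr' => hr r (by omega) (by omega), by
        rw [hr 20 (by omega) (by omega), h2]⟩
    · rintro y σ ⟨h1, -⟩
      rw [h1.1 0 (by omega), h0]
    · rintro y σ hy ⟨hI, hσx⟩ hσy
      have hbdd : σ.Bdd 22 (i.size ^ p₁) := by
        refine ⟨fun r hr => ?_, hI.2.2.1⟩
        have h1 := i.le_pow_size (c := p₁) (by omega)
        rcases Nat.lt_or_ge r 20 with h | h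
        · rw [hI.1 r h]; exact (hB.1 r h).trans (i.pow_size_le (by omega))
        · obtain rfl | rfl : r = 20 ∨ r = 21 := by omega
          · omega
          · omega
      obtain ⟨hea, hee⟩ := heval i s hs x hx y hy σ ⟨hI.1, hσx, hσy, hI.2.1⟩
      have h00 : σ.reg 0 = i.n := by rw [hI.1 0 (by omega), h0]
      obtain ⟨σ₁, t₁, he₁, hd₁, hm₁, hg₁, ht₁⟩ := (h₁ 22 42 i.size σ hwa (by omega) (by omega)
        (by omega) hb (by omega) hbdd).2 M ((i.pow_size_le (by omega)).trans_lt hM)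
      have hg₁' : ∀ r < 22, σ₁.reg r = σ.reg r := fun r hr => hg₁ r (Or.inl hr)
      obtain ⟨hv₂, hr₂⟩ := h₂ 22 43 i.size σ₁ hwe (by omega) (by omega)
        (by omega) hb (by rw [hg₁' 0 (by omega)]; omega) (hbdd.congr hm₁ hg₁')
      obtain ⟨σ₂, t₂, he₂, hd₂, hm₂, hg₂, ht₂⟩ := hr₂ M ((i.pow_size_le (by omega)).trans_lt hM)
      have hcell : σ₂.reg 42 = A i x y := by rw [hg₂ 42 (by omega), hd₁, hea]
      have hword : σ₂.reg 43 = F i x y := by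
        rw [hd₂, Arith.eval_congr hwe (by omega) hm₁ hg₁', hee]
      have hmem : ∀ c, (σ₂.setMem (σ₂.reg 42) (σ₂.reg 43)).mem c =
          if c = A i x y then F i x y else σ.mem c := fun c => by
        rw [State.setMem_mem, hcell, hword, hm₂, hm₁]
      have hreg : ∀ r < 22, (σ₂.setMem (σ₂.reg 42) (σ₂.reg 43)).reg r = σ.reg r := fun r hr => by
        rw [State.setMem_reg, hg₂ r (by omega), hg₁' r hr]
      refine ⟨σ₂.setMem (σ₂.reg 42) (σ₂.reg 43), t₁ + (t₂ + 1), .seq _ _ _ _ _ _ _ he₁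
        (.seq _ _ _ _ _ _ _ he₂ (.store _ _ _ ?_)), ⟨⟨?_, ?_, ?_, ?_⟩, ?_⟩, ?_, ?_⟩
      · rw [hd₂]; exact hv₂.trans_lt ((i.pow_size_le (by omega)).trans_lt hM)
      · intro r hr; rw [hreg r (by omega), hI.1 r hr]
      · intro c hc; rw [hmem, if_neg (hc x hx y hy), hI.2.1 c hc]
      · intro c; rw [hmem]; split_ifs
        · exact hF x hx y hy
        · exact hI.2.2.1 c
      · intro x' hx' y' hy' hlt
        rw [hmem]; split_ifs with h
        · exact hcons i x hx y hy x' hx' y' hy' h.symm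
        · refine hI.2.2.2 x' hx' y' hy' ?_
          by_contra hcon
          obtain ⟨rfl, rfl⟩ : x' = x ∧ y' = y := by omega
          exact h rfl
      · rw [hreg 20 (by omega), hσx]
      · rw [hreg 21 (by omega), hσy]
      · rw [h00, ← hX] at ht₁
        rw [hg₁' 0 (by omega), h00, ← hX] at ht₂
        have h1 : C₁ * X ^ a.depth ≤ C₁ * X ^ 1 :=
          Nat.mul_le_mul_left _ (Nat.pow_le_pow_right (by omega) hda)
        have h2 : C₂ * X ^ e.depth ≤ C₂ * X ^ 1 :=
          Nat.mul_le_mul_left _ (Nat.pow_le_pow_right (by omega) hde)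
        rw [pow_one] at h1 h2
        have h3 := ht₁.trans h1
        have h4 := ht₂.trans h2
        nlinarith
  obtain ⟨s', t, he, hI, ht⟩ := exec_forLoop (M := M) (x := 20) (f := 40) (n := i.n)
    (I := fun x σ => I x 0 σ)
    (body := forLoop 21 41 (.seq (a.code 42) (.seq (e.code 43) (.store 42 43)))) (s := s)
    (by omega) (by omega) (by omega) (by omega) (by omega)
    (fun x σ σ' h hm hr => hIcongr h hm fun r hr' => hr r (by omega) (by omega))
    (fun x σ h => by rw [h.1 0 (by omega), h0])
    (fun x σ hx hI hσx => by
      obtain ⟨σ', t, he, ⟨h1, h2⟩, ht⟩ := hin x σ hx hI hσx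
      exact ⟨σ', t, he, ⟨h1.1, h1.2.1, h1.2.2.1, fun x' hx' y' hy' h =>
        h1.2.2.2 x' hx' y' hy' (by omega)⟩, h2, ht⟩)
    ⟨fun r _ => rfl, fun c _ => rfl, fun c => (hB.2 c).trans (i.pow_size_le (by omega)),
      fun x' _ y' _ h => by omega⟩
  refine ⟨s', t, he, hpost i s s' hs ⟨hI.1, fun x hx y hy => hI.2.2.2 x hx y hy (Or.inl hx),
    hI.2.1⟩, ⟨fun r hr => ?_, hI.2.2.1⟩, ht.trans ?_⟩
  · rw [hI.1 r hr]; exact (hB.1 r hr).trans (i.pow_size_le (by omega))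
  · rw [← hX]
    have hX1 : 1 ≤ X := by omega
    have hnX : i.n ≤ X := by omega
    have h1 : (C₁ + C₂ + 1) * X + 4 ≤ (C₁ + C₂ + 5) * X := by nlinarith
    have h2 : i.n * ((C₁ + C₂ + 1) * X + 4) + 3 + 4 ≤ (C₁ + C₂ + 12) * X ^ 2 := by
      have := Nat.mul_le_mul hnX h1
      nlinarith
    have h3 := Nat.mul_le_mul hnX h2
    have h4 : 1 ≤ X ^ 3 := Nat.one_le_pow _ _ hX1
    calc _ ≤ X * ((C₁ + C₂ + 12) * X ^ 2) + 3 := by omega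
      _ = (C₁ + C₂ + 12) * X ^ 3 + 3 := by ring
      _ ≤ _ := by nlinarith

open Classical in
/-- The indicator of a proposition. -/
noncomputable def ind (p : Prop) : ℕ := if p then 1 else 0

/-! ### Notation for expressions, and addresses of arrays -/

namespace Arith

instance : Add Arith := ⟨bin .add⟩
instance : Mul Arith := ⟨bin .mul⟩
instance : Sub Arith := ⟨bin .sub⟩
instance (a : ℕ) : OfNat Arith a := ⟨lit a⟩

/-- The indicator of `e < f`. -/
def lt (e f : Arith) : Arith := bin .lt e f
/-- The indicator of `e ≤ f`. -/
def le (e f : Arith) : Arith := bin .lt e (f + 1)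
/-- The indicator of `e = f`. -/
def eq (e f : Arith) : Arith := bin .eq e f

section
variable (e f g : Arith) (s : State)

@[simp] theorem eval_add : (e + f).eval s = e.eval s + f.eval s := (rfl)
@[simp] theorem eval_mul : (e * f).eval s = e.eval s * f.eval s := (rfl)
@[simp] theorem eval_sub : (e - f).eval s = e.eval s - f.eval s := (rfl)
@[simp] theorem eval_ofNat (a : ℕ) : (ofNat(a) : Arith).eval s = a := (rfl)
@[simp] theorem eval_lit (a : ℕ) : (lit a).eval s = a := (rfl)
@[simp] theorem eval_var (i : ℕ) : (var i).eval s = s.reg i := (rfl)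
theorem eval_ld : (ld e).eval s = s.mem (e.eval s) := (rfl)
@[simp] theorem eval_lt : (lt e f).eval s = ind (e.eval s < f.eval s) := by
  change (if e.eval s < f.eval s then 1 else 0) = _
  unfold ind
  split_ifs <;> rfl
@[simp] theorem eval_le : (le e f).eval s = ind (e.eval s ≤ f.eval s) := by
  
  change (if e.eval s < f.eval s + 1 then 1 else 0) = _
  unfold ind
  simp only [Nat.lt_succ_iff]
  split_ifs <;> rfl
@[simp] theorem eval_eq : (eq e f).eval s = ind (e.eval s = f.eval s) := by
  change (if e.eval s = f.eval s then 1 else 0) = _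
  unfold ind
  split_ifs <;> rfl
@[simp] theorem eval_cond :
    (cond e f g).eval s = if e.eval s ≠ 0 then f.eval s else g.eval s := (rfl)
theorem eval_sum (x : ℕ) :
    (sum x e).eval s = ∑ j ∈ Finset.range (s.reg 0), e.eval (s.setReg x j) := (rfl)
end

/-- Well-formedness is decidable. -/
def decidableWF : ∀ (e : Arith) (l : ℕ), Decidable (e.WF l)
  | lit _, _ => .isTrue trivial
  | var i, l => inferInstanceAs (Decidable (i < l))
  | bin _ e f, l => @instDecidableAnd _ _ (decidableWF e l) (decidableWF f l)
  | ld e, l => decidableWF e l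
  | cond c e f, l => @instDecidableAnd _ _ (decidableWF c l)
      (@instDecidableAnd _ _ (decidableWF e l) (decidableWF f l))
  | sum x e, l => @instDecidableAnd _ _ (inferInstanceAs (Decidable (x = l)))
      (@instDecidableAnd _ _ (inferInstanceAs (Decidable (l < 40))) (decidableWF e (l + 1)))

instance (e : Arith) (l : ℕ) : Decidable (e.WF l) := decidableWF e l

/-- The address `a n ^ 2 + c n`. -/
def base (a c : ℕ) : Arith := lit a * (var 0 * var 0) + lit c * var 0

/-- The address of the entry `y` of the vector at `base a c`. -/
def addr₁ (a c : ℕ) (y : Arith) : Arith := base a c + y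

/-- The address of the entry `(x, y)` of the matrix at `base a c`. -/
def addr₂ (a c : ℕ) (x y : Arith) : Arith := base a c + (x * var 0 + y)

end Arith

/-! ### Arrays in memory and assertions stable under later writes -/

/-- The vector `f` is stored at the address `a n ^ 2 + c n`. -/
def Vec (a c : ℕ) (f : Input → ℕ → ℕ) (i : Input) (s : State) : Prop :=
  ∀ y < i.n, s.mem (a * (i.n * i.n) + c * i.n + y) = f i y

/-- The matrix `f` is stored at the address `a n ^ 2 + c n`. -/
def Mat (a c : ℕ) (f : Input → ℕ → ℕ → ℕ) (i : Input) (s : State) : Prop :=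
  ∀ x < i.n, ∀ y < i.n, s.mem (a * (i.n * i.n) + c * i.n + (x * i.n + y)) = f i x y

/-- An assertion that fixes the value of register `0` and depends only on the registers less than
`R` and, if `n ≠ 0`, on the memory below the address `a n ^ 2 + c n`. -/
structure Local (S : Input → State → Prop) (R a c : ℕ) : Prop where
  reg_zero : ∀ i s, S i s → s.reg 0 = i.n
  congr : ∀ i s s', S i s → (∀ r < R, s'.reg r = s.reg r) →
    (∀ b < a * (i.n * i.n) + c * i.n, s'.mem b = s.mem b) → (i.n = 0 → s'.mem = s.mem) → S i s'

theorem mul_add_lt_sq {n x y : ℕ} (hx : x < n) (hy : y < n) : x * n + y < n * n := by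
  nlinarith

theorem mul_add_inj {n x y x' y' : ℕ} (hy : y < n) (hy' : y' < n) (h : x * n + y = x' * n + y') :
    x = x' ∧ y = y' := by
  have hn : 0 < n := by omega
  have h1 : (x * n + y) / n = (x' * n + y') / n := by rw [h]
  rw [mul_comm x, mul_comm x', Nat.mul_add_div hn, Nat.mul_add_div hn, Nat.div_eq_of_lt hy,
    Nat.div_eq_of_lt hy'] at h1
  have h2 : x = x' := by simpa using h1
  subst h2
  exact ⟨rfl, by omega⟩

variable {S : Input → State → Prop} {R a c : ℕ}

/-- The bound in `Local` acts as the first free address, which a vector advances by `n` and a matrix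
by `n ^ 2`. -/
theorem Local.and_vec (h : Local S R a c) (f : Input → ℕ → ℕ) :
    Local (fun i s => S i s ∧ Vec a c f i s) R a (c + 1) := by
  refine ⟨fun i s hs => h.reg_zero i s hs.1, fun i s s' hs hr hm hz => ⟨?_, fun y hy => ?_⟩⟩
  · exact h.congr i s s' hs.1 hr (fun b hb => hm b (by rw [add_mul]; omega)) hz
  · rw [hm _ (by rw [add_mul]; omega), hs.2 y hy]

theorem Local.and_mat (h : Local S R a c) (f : Input → ℕ → ℕ → ℕ) :
    Local (fun i s => S i s ∧ Mat a c f i s) R (a + 1) c := by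
  refine ⟨fun i s hs => h.reg_zero i s hs.1, fun i s s' hs hr hm hz => ⟨?_, fun x hx y hy => ?_⟩⟩
  · exact h.congr i s s' hs.1 hr (fun b hb => hm b (by rw [add_mul]; omega)) hz
  · have := mul_add_lt_sq hx hy
    rw [hm _ (by rw [add_mul]; omega), hs.2 x hx y hy]

theorem Local.and_reg (h : Local S R a c) (v : Input → ℕ) :
    Local (fun i s => S i s ∧ s.reg R = v i) (R + 1) a c :=
  ⟨fun i s hs => h.reg_zero i s hs.1, fun i s s' hs hr hm hz =>
    ⟨h.congr i s s' hs.1 (fun r hr' => hr r (by omega)) hm hz, by rw [hr R (by omega), hs.2]⟩⟩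

/-- Filling cells on which the assertion `S` does not depend. -/
theorem achieves_fill_of_stable {ad e : Arith} (A F : Input → ℕ → ℕ → ℕ)
    (hn : ∀ i s, S i s → s.reg 0 = i.n)
    (hstable : ∀ i s s', S i s → (∀ r < 20, s'.reg r = s.reg r) →
      (∀ b, (∀ x < i.n, ∀ y < i.n, b ≠ A i x y) → s'.mem b = s.mem b) → S i s')
    (hA : ∀ i s, S i s → ad.eval s = A i (s.reg 20) (s.reg 21))
    (hcons : ∀ (i : Input), ∀ x < i.n, ∀ y < i.n, ∀ x' < i.n, ∀ y' < i.n, A i x y = A i x' y' →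
      F i x y = F i x' y')
    (hwa : ad.WF 22) (hwe : e.WF 22) (hda : ad.depth ≤ 1) (hde : e.depth ≤ 1)
    (hF : ∀ i s, S i s → s.reg 20 < i.n → s.reg 21 < i.n →
      e.eval s = F i (s.reg 20) (s.reg 21)) :
    Achieves (fill ad e) S fun i s => S i s ∧ ∀ x < i.n, ∀ y < i.n, s.mem (A i x y) = F i x y := by
  refine achieves_fill A F hwa hwe hda hde hn (fun i s hs x hx y hy σ hσ => ?_) hcons
    fun i s s' hs h => ⟨hstable i s s' hs h.reg h.mem, h.mem_fill⟩
  have hSσ := hstable i s σ hs hσ.reg hσ.mem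
  obtain ⟨-, rfl, rfl, -⟩ := hσ
  exact ⟨hA i σ hSσ, hF i σ hSσ hx hy⟩

/-- The address ignores the row, so the vector is written `n` times with the same values; the time
remains cubic. -/
theorem Local.achieves_vec (h : Local S R a c) {e : Arith} (f : Input → ℕ → ℕ) (hR : R ≤ 20)
    (hwe : e.WF 22) (hde : e.depth ≤ 1)
    (hF : ∀ i s, S i s → s.reg 20 < i.n → s.reg 21 < i.n → e.eval s = f i (s.reg 21)) :
    Achieves (fill (.addr₁ a c (.var 21)) e) S fun i s => S i s ∧ Vec a c f i s := by
  have key := achieves_fill_of_stable (S := S) (ad := .addr₁ a c (.var 21)) (e := e)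
    (fun i _ y => a * (i.n * i.n) + c * i.n + y) (fun i _ y => f i y) h.reg_zero
    (fun i s s' hs hr hm => h.congr i s s' hs (fun r hr' => hr r (by omega))
      (fun b hb => hm b fun x _ y _ => by omega) fun hz => funext fun b => hm b fun x hx => by omega)
    (fun i s hs => by simp [Arith.addr₁, Arith.base, h.reg_zero i s hs])
    (fun i x _ y _ x' _ y' _ hxy => by
      obtain rfl : y = y' := by omega
      rfl)
    ⟨⟨⟨trivial, by decide, by decide⟩, trivial, by decide⟩, by decide⟩
    hwe (Nat.zero_le 1) hde hF
  intro p
  obtain ⟨q, c, C, hC⟩ := key p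
  refine ⟨q, c, C, fun i s hs hB M hM => ?_⟩
  obtain ⟨s', t, he, hp, hB', ht⟩ := hC i s hs hB M hM
  exact ⟨s', t, he, ⟨hp.1, fun y hy => hp.2 y hy y hy⟩, hB', ht⟩

theorem Local.achieves_mat (h : Local S R a c) {e : Arith} (f : Input → ℕ → ℕ → ℕ) (hR : R ≤ 20)
    (hwe : e.WF 22) (hde : e.depth ≤ 1)
    (hF : ∀ i s, S i s → s.reg 20 < i.n → s.reg 21 < i.n →
      e.eval s = f i (s.reg 20) (s.reg 21)) :
    Achieves (fill (.addr₂ a c (.var 20) (.var 21)) e) S fun i s => S i s ∧ Mat a c f i s :=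
  achieves_fill_of_stable (S := S) (ad := .addr₂ a c (.var 20) (.var 21)) (e := e)
    (fun i x y => a * (i.n * i.n) + c * i.n + (x * i.n + y)) f h.reg_zero
    (fun i s s' hs hr hm => h.congr i s s' hs (fun r hr' => hr r (by omega))
      (fun b hb => hm b fun x _ y _ => by omega) fun hz => funext fun b => hm b fun x hx => by omega)
    (fun i s hs => by simp [Arith.addr₂, Arith.base, h.reg_zero i s hs])
    (fun i x _ y hy x' _ y' hy' hxy => by
      obtain ⟨rfl, rfl⟩ := mul_add_inj hy hy' (Nat.add_left_cancel hxy)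
      rfl)
    ⟨⟨⟨trivial, by decide, by decide⟩, trivial, by decide⟩, ⟨by decide, by decide⟩, by decide⟩
    hwe (Nat.zero_le 1) hde hF

theorem Local.achieves_assign (h : Local S R a c) {e : Arith} (v : Input → ℕ)
    (hwe : e.WF 20) (hde : e.depth ≤ 3) (hR : R ≤ 20) (hv : ∀ i s, S i s → e.eval s = v i) :
    Achieves (assign R e) S fun i s => S i s ∧ s.reg R = v i :=
  SemicompletePathwidth.achieves_assign hwe hde h.reg_zero fun i s s' hs hm hx hr =>
    ⟨h.congr i s s' hs (fun r hr' => hr r (by omega) (by omega)) (fun b _ => by rw [hm]) fun _ => hm,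
      by rw [hx, hv i s hs]⟩

theorem Vec.eval_ld {f : Input → ℕ → ℕ} {i : Input} {s σ : State} (h : Vec a c f i s)
    {y : Arith} (hm : σ.mem = s.mem) (h0 : σ.reg 0 = i.n) (hy : y.eval σ < i.n) :
    (Arith.ld (.addr₁ a c y)).eval σ = f i (y.eval σ) := by
  simp only [Arith.eval_ld, Arith.addr₁, Arith.base, Arith.eval_add, Arith.eval_mul, Arith.eval_lit,
    Arith.eval_var, h0, hm]
  exact h _ hy

theorem Vec.eval_ld_self {f : Input → ℕ → ℕ} {i : Input} {s : State} (h : Vec a c f i s)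
    {y : Arith} (h0 : s.reg 0 = i.n) (hy : y.eval s < i.n) :
    (Arith.ld (.addr₁ a c y)).eval s = f i (y.eval s) := h.eval_ld rfl h0 hy

theorem Mat.eval_ld {f : Input → ℕ → ℕ → ℕ} {i : Input} {s σ : State} (h : Mat a c f i s)
    {x y : Arith} (hm : σ.mem = s.mem) (h0 : σ.reg 0 = i.n) (hx : x.eval σ < i.n)
    (hy : y.eval σ < i.n) :
    (Arith.ld (.addr₂ a c x y)).eval σ = f i (x.eval σ) (y.eval σ) := by
  simp only [Arith.eval_ld, Arith.addr₂, Arith.base, Arith.eval_add, Arith.eval_mul, Arith.eval_lit,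
    Arith.eval_var, h0, hm]
  exact h _ hx _ hy

theorem Mat.eval_ld_self {f : Input → ℕ → ℕ → ℕ} {i : Input} {s : State} (h : Mat a c f i s)
    {x y : Arith} (h0 : s.reg 0 = i.n) (hx : x.eval s < i.n) (hy : y.eval s < i.n) :
    (Arith.ld (.addr₂ a c x y)).eval s = f i (x.eval s) (y.eval s) := h.eval_ld rfl h0 hx hy

/-! ### The algorithm -/

noncomputable section

namespace Input

variable (i : Input)

/-- The number of consecutive ranks that guarantees a jump of the out-degree. -/
def gap : ℕ := 11 * i.k - 13
/-- The number of ranks between the two sides of a cut. -/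
def window : ℕ := 2 * i.gap + i.k
/-- The maximum size of a bag. -/
def cap : ℕ := 4 * (i.k * i.k) + 7 * i.k + 1
/-- The entries of the adjacency matrix. -/
def adjN (u v : ℕ) : ℕ := (inputState i.T i.k).mem (u * i.n + v)
/-- The out-degrees. -/
def degN (v : ℕ) : ℕ := ∑ u ∈ Finset.range i.n, i.adjN v u
/-- The ranks. -/
def rkN (v : ℕ) : ℕ := ∑ u ∈ Finset.range i.n,
  (ind (i.degN u < i.degN v) + ind (i.degN u = i.degN v) * ind (u < v))
/-- The indicator of the vertices with the ranks `x, …, x + gap - 1`. -/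
def inN (x v : ℕ) : ℕ := ind (x ≤ i.rkN v) * ind (i.rkN v < x + i.gap)
/-- The number of vertices whose rank is in the same window and whose out-degree is larger by `k`. -/
def jumpN (x u : ℕ) : ℕ := ∑ v ∈ Finset.range i.n,
  i.inN x u * i.inN x v * ind (i.degN u + i.k ≤ i.degN v)
/-- The in-degrees from the vertices of rank less than `x`. -/
def lowN (x v : ℕ) : ℕ := ∑ u ∈ Finset.range i.n, ind (i.rkN u < x) * i.adjN u v
/-- The indicators of the bags. -/
def bagN (x v : ℕ) : ℕ := ind (0 < ind (x ≤ i.rkN v) * ind (i.rkN v ≤ x + i.window) +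
  ind (x + i.window ≤ i.rkN v) * ind (i.k ≤ i.lowN x v) +
  ind (i.rkN v < x) * ∑ v' ∈ Finset.range i.n,
    i.adjN v v' * ind (x + i.window ≤ i.rkN v') * ind (i.lowN x v' ≤ i.k))
/-- The indicators of the windows with nearly equal out-degrees. -/
def tangleN (x : ℕ) : ℕ := ind (x + i.gap ≤ i.n) * ind (∑ u ∈ Finset.range i.n, i.jumpN x u = 0)
/-- The indicators of the large bags. -/
def largeN (x : ℕ) : ℕ :=
  ind (x + i.window < i.n) * ind (i.cap < ∑ v ∈ Finset.range i.n, i.bagN x v)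
/-- The number of the first window with nearly equal out-degrees. -/
def firstTangle : ℕ := ∑ x ∈ Finset.range i.n,
  ind (∑ x' ∈ Finset.range i.n, ind (x' ≤ x) * i.tangleN x' = 0)
/-- The number of the first large bag. -/
def firstLarge : ℕ := ∑ x ∈ Finset.range i.n,
  ind (∑ x' ∈ Finset.range i.n, ind (x' ≤ x) * i.largeN x' = 0)
/-- Whether all vertices fit into a single bag. -/
def smallN : ℕ := ind (i.n ≤ i.cap)
/-- Whether the output is a jungle. -/
def jungleN : ℕ := if i.smallN ≠ 0 then 0 else if ind (i.k < 2) ≠ 0 then 1 else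
  if ind (i.firstTangle < i.n) ≠ 0 then 1 else ind (i.firstLarge < i.n)
/-- The indicator of a set of at least `k` vertices that are linked to each other. -/
def candN (v : ℕ) : ℕ := if ind (i.k < 2) ≠ 0 then 1 else
  if ind (i.firstTangle < i.n) ≠ 0 then i.inN i.firstTangle v *
    ind (5 * i.k ≤ (∑ u ∈ Finset.range i.n, i.inN i.firstTangle u * i.adjN u v) + 6)
  else ind (i.firstLarge + i.gap ≤ i.rkN v) * ind (i.rkN v < i.firstLarge + i.gap + i.k)
/-- The indicators of the sets in the output. -/
def outN (x v : ℕ) : ℕ := if i.jungleN ≠ 0 then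
    i.candN v * ind (∑ v' ∈ Finset.range i.n, ind (v' < v) * i.candN v' < i.k)
  else if i.smallN ≠ 0 then 1 else i.bagN x v
/-- The positions in the output lists. -/
def posN (x v : ℕ) : ℕ := ∑ u ∈ Finset.range i.n, ind (u < v) * i.outN x u
/-- The entries of the output lists. -/
def itemN (x y : ℕ) : ℕ := ∑ v ∈ Finset.range i.n, v * (i.outN x v * ind (i.posN x v = y))
/-- The lengths of the output lists. -/
def headN (x : ℕ) : ℕ := ∑ v ∈ Finset.range i.n, i.outN x v
/-- The number of output lists. -/
def countN : ℕ := if i.smallN ≠ 0 then 1 else i.n - i.window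

end Input

end

/-! ### The expressions of the algorithm and the memory layout -/

namespace Code

open Arith

/-- The arrays lie one after the other behind the adjacency matrix, each at an address `a n ^ 2 + c
n`. -/
def adj (x y : Arith) : Arith := ld (addr₂ 0 0 x y)
def deg (y : Arith) : Arith := ld (addr₁ 1 0 y)
def rk (y : Arith) : Arith := ld (addr₁ 1 1 y)
def jump (x y : Arith) : Arith := ld (addr₂ 1 2 x y)
def low (x y : Arith) : Arith := ld (addr₂ 2 2 x y)
def bag (x y : Arith) : Arith := ld (addr₂ 3 2 x y)
def cand (y : Arith) : Arith := ld (addr₁ 4 2 y)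
def out (x y : Arith) : Arith := ld (addr₂ 4 3 x y)
def pos (x y : Arith) : Arith := ld (addr₂ 5 3 x y)
-- A list takes `n + 1` cells, for its length and up to `n` entries.
def headAddr (x : Arith) : Arith := base 6 3 + x * (var 0 + 1)

def gap : Arith := 11 * var 1 - 13
def window : Arith := 2 * gap + var 1
def cap : Arith := 4 * (var 1 * var 1) + 7 * var 1 + 1
def inWin (x v : Arith) : Arith := le x (rk v) * lt (rk v) (x + gap)

/-- Registers `20` and `21` are the row and the column of the array being filled, and `22` is the
summation index. -/
def degE : Arith := sum 22 (adj (var 21) (var 22))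
def rkE : Arith := sum 22 (lt (deg (var 22)) (deg (var 21)) +
  eq (deg (var 22)) (deg (var 21)) * lt (var 22) (var 21))
def jumpE : Arith := sum 22 (inWin (var 20) (var 21) * inWin (var 20) (var 22) *
  le (deg (var 21) + var 1) (deg (var 22)))
def lowE : Arith := sum 22 (lt (rk (var 22)) (var 20) * adj (var 22) (var 21))
def bagE : Arith := lt 0 (le (var 20) (rk (var 21)) * le (rk (var 21)) (var 20 + window) +
  le (var 20 + window) (rk (var 21)) * le (var 1) (low (var 20) (var 21)) +
  lt (rk (var 21)) (var 20) * sum 22 (adj (var 21) (var 22) *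
    le (var 20 + window) (rk (var 22)) * le (low (var 20) (var 22)) (var 1)))
def tangleE : Arith := le (var 21 + gap) (var 0) * eq (sum 22 (jump (var 21) (var 22))) 0
def largeE : Arith := lt (var 21 + window) (var 0) * lt cap (sum 22 (bag (var 21) (var 22)))
-- Search without a loop exit: the number of indices up to which the indicator `e` has not occurred
-- is the first occurrence, or `n` if there is none.
def first (e : Arith) : Arith := sum 20 (eq (sum 21 (le (var 21) (var 20) * e)) 0)
def smallE : Arith := le (var 0) cap
def jungleE : Arith := cond (var 4) 0 (cond (lt (var 1) 2) 1 (cond (lt (var 2) (var 0)) 1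
  (lt (var 3) (var 0))))
def candE : Arith := cond (lt (var 1) 2) 1 (cond (lt (var 2) (var 0))
  (inWin (var 2) (var 21) *
    le (5 * var 1) (sum 22 (inWin (var 2) (var 22) * adj (var 22) (var 21)) + 6))
  (le (var 3 + gap) (rk (var 21)) * lt (rk (var 21)) (var 3 + gap + var 1)))
def outE : Arith := cond (var 5)
  (cand (var 21) * lt (sum 22 (lt (var 22) (var 21) * cand (var 22))) (var 1))
  (cond (var 4) 1 (bag (var 20) (var 21)))
def posE : Arith := sum 22 (lt (var 22) (var 21) * out (var 20) (var 22))
def itemE : Arith := sum 22 (var 22 * (out (var 20) (var 22) * eq (pos (var 20) (var 22)) (var 21)))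
def headE : Arith := sum 22 (out (var 21) (var 22))
-- In the jungle case register `1` must hold the address of the first list, otherwise the number of
-- bags.
def countE : Arith := cond (var 5) (base 6 3) (cond (var 4) 1 (var 0 - window))

end Code

open Code Arith in
/-- The algorithm: it computes the out-degrees, the ranks, and the bags. -/
def algorithm : Prog :=
  .seq (fill (addr₁ 1 0 (var 21)) degE) <|
  .seq (fill (addr₁ 1 1 (var 21)) rkE) <|
  -- Tabulating this and the next matrix removes one level of sums from the later expressions and
  -- keeps the time cubic.
  .seq (fill (addr₂ 1 2 (var 20) (var 21)) jumpE) <|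
  .seq (fill (addr₂ 2 2 (var 20) (var 21)) lowE) <|
  .seq (fill (addr₂ 3 2 (var 20) (var 21)) bagE) <|
  .seq (assign 2 (first tangleE)) <|
  .seq (assign 3 (first largeE)) <|
  .seq (assign 4 smallE) <|
  .seq (assign 5 jungleE) <|
  .seq (fill (addr₁ 4 2 (var 21)) candE) <|
  .seq (fill (addr₂ 4 3 (var 20) (var 21)) outE) <|
  .seq (fill (addr₂ 5 3 (var 20) (var 21)) posE) <|
  .seq (fill (headAddr (var 20) + (1 + var 21)) itemE) <|
  .seq (fill (headAddr (var 21)) headE) <|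
  .seq (fill (addr₁ 7 4 (var 21)) (headAddr (var 21))) <|
  .seq (assign 2 (base 7 4)) <|
  -- Registers `1` and `0` are overwritten last, in this order, because `countE` still needs `k` and
  -- `n`.
  .seq (assign 1 countE) (assign 0 (var 5))

/-! ### The stages of the algorithm -/

namespace Stage

open Input

/-- For `n = 0` no cell is ever written, yet the single empty bag has to be listed; the zero memory
provides this list. -/
def start (i : Input) (s : State) : Prop :=
  (s.reg 0 = i.n ∧ s.reg 1 = i.k ∧ (i.n = 0 → ∀ b, s.mem b = 0)) ∧ Mat 0 0 adjN i s
def deg (i : Input) (s : State) : Prop := start i s ∧ Vec 1 0 degN i s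
def rk (i : Input) (s : State) : Prop := deg i s ∧ Vec 1 1 rkN i s
def jump (i : Input) (s : State) : Prop := rk i s ∧ Mat 1 2 jumpN i s
def low (i : Input) (s : State) : Prop := jump i s ∧ Mat 2 2 lowN i s
def bag (i : Input) (s : State) : Prop := low i s ∧ Mat 3 2 bagN i s
def tangle (i : Input) (s : State) : Prop := bag i s ∧ s.reg 2 = i.firstTangle
def large (i : Input) (s : State) : Prop := tangle i s ∧ s.reg 3 = i.firstLarge
def small (i : Input) (s : State) : Prop := large i s ∧ s.reg 4 = i.smallN
def jungle (i : Input) (s : State) : Prop := small i s ∧ s.reg 5 = i.jungleN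
def cand (i : Input) (s : State) : Prop := jungle i s ∧ Vec 4 2 candN i s
def out (i : Input) (s : State) : Prop := cand i s ∧ Mat 4 3 outN i s
def pos (i : Input) (s : State) : Prop := out i s ∧ Mat 5 3 posN i s

theorem local_start : Local start 2 1 0 := by
  refine ⟨fun i s hs => hs.1.1, fun i s s' hs hr hm hz => ⟨⟨?_, ?_, ?_⟩, fun x hx y hy => ?_⟩⟩
  · rw [hr 0 (by omega), hs.1.1]
  · rw [hr 1 (by omega), hs.1.2.1]
  · intro h; rw [hz h]; exact hs.1.2.2 h
  · have := mul_add_lt_sq hx hy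
    rw [hm _ (by omega), hs.2 x hx y hy]

theorem local_deg : Local deg 2 1 1 := local_start.and_vec _
theorem local_rk : Local rk 2 1 2 := local_deg.and_vec _
theorem local_jump : Local jump 2 2 2 := local_rk.and_mat _
theorem local_low : Local low 2 3 2 := local_jump.and_mat _
theorem local_bag : Local bag 2 4 2 := local_low.and_mat _
theorem local_tangle : Local tangle 3 4 2 := local_bag.and_reg _
theorem local_large : Local large 4 4 2 := local_tangle.and_reg _
theorem local_small : Local small 5 4 2 := local_large.and_reg _
theorem local_jungle : Local jungle 6 4 2 := local_small.and_reg _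
theorem local_cand : Local cand 6 4 3 := local_jungle.and_vec _
theorem local_out : Local out 6 5 3 := local_cand.and_mat _
theorem local_pos : Local pos 6 6 3 := local_out.and_mat _

end Stage

/-! ### Verification of the single stages -/

set_option linter.unusedSimpArgs false

theorem Arith.eval_sum_congr {i : Input} {x : ℕ} {e : Arith} {s : State} {f : ℕ → ℕ}
    (h0 : s.reg 0 = i.n) (h : ∀ j < i.n, e.eval (s.setReg x j) = f j) :
    (Arith.sum x e).eval s = ∑ j ∈ Finset.range i.n, f j := by
  rw [Arith.eval_sum, h0]
  exact Finset.sum_congr rfl fun j hj => h j (Finset.mem_range.1 hj)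

theorem achieves_deg : Achieves (fill (.addr₁ 1 0 (.var 21)) Code.degE) Stage.start Stage.deg := by
  refine Stage.local_start.achieves_vec Input.degN (by decide) (by decide) (by decide)
    fun i s hs hx hy => ?_
  obtain ⟨⟨h0, h1, -⟩, hadj⟩ := hs
  refine Arith.eval_sum_congr h0 fun j hj => ?_
  simp [Code.adj, hadj.eval_ld, State.setReg_reg, h0, hx, hy, hj]

theorem achieves_rk : Achieves (fill (.addr₁ 1 1 (.var 21)) Code.rkE) Stage.deg Stage.rk := by
  refine Stage.local_deg.achieves_vec Input.rkN (by decide) (by decide) (by decide)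
    fun i s hs hx hy => ?_
  obtain ⟨⟨⟨h0, h1, -⟩, hadj⟩, hdeg⟩ := hs
  refine Arith.eval_sum_congr h0 fun j hj => ?_
  simp [Code.deg, hdeg.eval_ld, State.setReg_reg, h0, hx, hy, hj]

theorem achieves_jump :
    Achieves (fill (.addr₂ 1 2 (.var 20) (.var 21)) Code.jumpE) Stage.rk Stage.jump := by
  refine Stage.local_rk.achieves_mat Input.jumpN (by decide) (by decide) (by decide)
    fun i s hs hx hy => ?_
  obtain ⟨⟨⟨⟨h0, h1, -⟩, hadj⟩, hdeg⟩, hrk⟩ := hs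
  refine Arith.eval_sum_congr h0 fun j hj => ?_
  simp [Code.deg, Code.rk, Code.inWin, Code.gap, Input.gap, Input.inN, hdeg.eval_ld, hrk.eval_ld,
    State.setReg_reg, h0, h1, hx, hy, hj]

theorem achieves_low :
    Achieves (fill (.addr₂ 2 2 (.var 20) (.var 21)) Code.lowE) Stage.jump Stage.low := by
  refine Stage.local_jump.achieves_mat Input.lowN (by decide) (by decide) (by decide)
    fun i s hs hx hy => ?_
  obtain ⟨⟨⟨⟨⟨h0, h1, -⟩, hadj⟩, hdeg⟩, hrk⟩, -⟩ := hs
  refine Arith.eval_sum_congr h0 fun j hj => ?_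
  simp [Code.rk, Code.adj, hadj.eval_ld, hrk.eval_ld, State.setReg_reg, h0, hx, hy, hj]

theorem achieves_bag :
    Achieves (fill (.addr₂ 3 2 (.var 20) (.var 21)) Code.bagE) Stage.low Stage.bag := by
  refine Stage.local_low.achieves_mat Input.bagN (by decide) (by decide) (by decide)
    fun i s hs hx hy => ?_
  obtain ⟨⟨⟨⟨⟨⟨h0, h1, -⟩, hadj⟩, hdeg⟩, hrk⟩, -⟩, hlow⟩ := hs
  have hsum := Arith.eval_sum_congr (i := i) (x := 22) (s := s) (e := Code.adj (.var 21) (.var 22) *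
    .le (.var 20 + Code.window) (Code.rk (.var 22)) * .le (Code.low (.var 20) (.var 22)) (.var 1))
    (f := fun v' => i.adjN (s.reg 21) v' * ind (s.reg 20 + i.window ≤ i.rkN v') *
      ind (i.lowN (s.reg 20) v' ≤ i.k)) h0 fun j hj => by
    simp [Code.rk, Code.adj, Code.low, Code.window, Code.gap, Input.window, Input.gap,
      hadj.eval_ld, hrk.eval_ld, hlow.eval_ld, State.setReg_reg, h0, h1, hx, hy, hj]
  unfold Code.bagE Input.bagN
  simp only [Arith.eval_lt, Arith.eval_add, Arith.eval_mul, hsum]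
  simp [Code.rk, Code.low, Code.window, Code.gap, Input.window, Input.gap,
    hrk.eval_ld_self, hlow.eval_ld_self, h0, h1, hx, hy]

theorem eval_first {i : Input} {s : State} {e : Arith} {f : ℕ → ℕ} (h0 : s.reg 0 = i.n)
    (h : ∀ x < i.n, ∀ x' < i.n, e.eval ((s.setReg 20 x).setReg 21 x') = f x') :
    (Code.first e).eval s = ∑ x ∈ Finset.range i.n,
      ind (∑ x' ∈ Finset.range i.n, ind (x' ≤ x) * f x' = 0) := by
  refine Arith.eval_sum_congr h0 fun x hx => ?_
  have h0' : (s.setReg 20 x).reg 0 = i.n := by simp [State.setReg_reg, h0]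
  have hsum := Arith.eval_sum_congr (i := i) (x := 21) (s := s.setReg 20 x)
    (e := .le (.var 21) (.var 20) * e) (f := fun x' => ind (x' ≤ x) * f x') h0' fun x' hx' => by
    rw [Arith.eval_mul, h x hx x' hx']
    simp [State.setReg_reg]
  simp only [Arith.eval_eq, hsum]
  rfl

theorem achieves_tangle :
    Achieves (assign 2 (Code.first Code.tangleE)) Stage.bag Stage.tangle := by
  refine Stage.local_bag.achieves_assign Input.firstTangle (by decide) (by decide) (by decide)
    fun i s hs => ?_
  obtain ⟨⟨⟨⟨⟨⟨⟨h0, h1, -⟩, hadj⟩, hdeg⟩, hrk⟩, hjump⟩, hlow⟩, hbag⟩ := hs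
  refine eval_first h0 fun x hx x' hx' => ?_
  have hsum := Arith.eval_sum_congr (i := i) (x := 22) (s := (s.setReg 20 x).setReg 21 x')
    (e := Code.jump (.var 21) (.var 22)) (f := fun u => i.jumpN x' u)
    (by simp [State.setReg_reg, h0]) fun j hj => by
    simp [Code.jump, hjump.eval_ld, State.setReg_reg, h0, hx', hj]
  unfold Code.tangleE Input.tangleN
  simp only [Arith.eval_mul, Arith.eval_eq, hsum]
  simp [Code.gap, Input.gap, State.setReg_reg, h0, h1]

theorem achieves_large :
    Achieves (assign 3 (Code.first Code.largeE)) Stage.tangle Stage.large := by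
  refine Stage.local_tangle.achieves_assign Input.firstLarge (by decide) (by decide) (by decide)
    fun i s hs => ?_
  obtain ⟨⟨⟨⟨⟨⟨⟨⟨h0, h1, -⟩, hadj⟩, hdeg⟩, hrk⟩, hjump⟩, hlow⟩, hbag⟩, -⟩ := hs
  refine eval_first h0 fun x hx x' hx' => ?_
  have hsum := Arith.eval_sum_congr (i := i) (x := 22) (s := (s.setReg 20 x).setReg 21 x')
    (e := Code.bag (.var 21) (.var 22)) (f := fun u => i.bagN x' u)
    (by simp [State.setReg_reg, h0]) fun j hj => by
    simp [Code.bag, hbag.eval_ld, State.setReg_reg, h0, hx', hj]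
  unfold Code.largeE Input.largeN
  simp only [Arith.eval_mul, Arith.eval_lt, hsum]
  simp [Code.window, Code.gap, Code.cap, Input.window, Input.gap, Input.cap, State.setReg_reg,
    h0, h1]

theorem achieves_small : Achieves (assign 4 Code.smallE) Stage.large Stage.small := by
  refine Stage.local_large.achieves_assign Input.smallN (by decide) (by decide) (by decide)
    fun i s hs => ?_
  obtain ⟨⟨⟨⟨⟨⟨⟨⟨⟨h0, h1, -⟩, hadj⟩, hdeg⟩, hrk⟩, hjump⟩, hlow⟩, hbag⟩, -⟩, -⟩ := hs
  simp [Code.smallE, Code.cap, Input.smallN, Input.cap, h0, h1]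

theorem achieves_jungle : Achieves (assign 5 Code.jungleE) Stage.small Stage.jungle := by
  refine Stage.local_small.achieves_assign Input.jungleN (by decide) (by decide) (by decide)
    fun i s hs => ?_
  obtain ⟨⟨⟨⟨⟨⟨⟨⟨⟨⟨h0, h1, -⟩, -⟩, -⟩, -⟩, -⟩, -⟩, -⟩, h2⟩, h3⟩, h4⟩ := hs
  simp [Code.jungleE, Input.jungleN, h0, h1, h2, h3, h4]

theorem achieves_cand :
    Achieves (fill (.addr₁ 4 2 (.var 21)) Code.candE) Stage.jungle Stage.cand := by
  refine Stage.local_jungle.achieves_vec Input.candN (by decide) (by decide) (by decide)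
    fun i s hs hx hy => ?_
  obtain ⟨⟨⟨⟨⟨⟨⟨⟨⟨⟨⟨h0, h1, -⟩, hadj⟩, -⟩, hrk⟩, -⟩, -⟩, -⟩, h2⟩, h3⟩, h4⟩, h5⟩ := hs
  have hsum := Arith.eval_sum_congr (i := i) (x := 22) (s := s)
    (e := Code.inWin (.var 2) (.var 22) * Code.adj (.var 22) (.var 21))
    (f := fun u => i.inN i.firstTangle u * i.adjN u (s.reg 21)) h0 fun j hj => by
    simp [Code.rk, Code.adj, Code.inWin, Code.gap, Input.gap, Input.inN, hadj.eval_ld, hrk.eval_ld,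
      State.setReg_reg, h0, h1, h2, hy, hj]
  unfold Code.candE Input.candN
  simp only [Arith.eval_cond, Arith.eval_mul, Arith.eval_le, Arith.eval_add, hsum]
  simp [Code.rk, Code.inWin, Code.gap, Input.gap, Input.inN, hrk.eval_ld_self, h0, h1, h2, h3, hy]

theorem achieves_out :
    Achieves (fill (.addr₂ 4 3 (.var 20) (.var 21)) Code.outE) Stage.cand Stage.out := by
  refine Stage.local_cand.achieves_mat Input.outN (by decide) (by decide) (by decide)
    fun i s hs hx hy => ?_
  obtain ⟨⟨⟨⟨⟨⟨⟨⟨⟨⟨⟨⟨h0, h1, -⟩, -⟩, -⟩, -⟩, -⟩, -⟩, hbag⟩, -⟩, -⟩, h4⟩, h5⟩, hcand⟩ := hs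
  have hsum := Arith.eval_sum_congr (i := i) (x := 22) (s := s)
    (e := .lt (.var 22) (.var 21) * Code.cand (.var 22))
    (f := fun v' => ind (v' < s.reg 21) * i.candN v') h0 fun j hj => by
    simp [Code.cand, hcand.eval_ld, State.setReg_reg, h0, hj]
  unfold Code.outE Input.outN
  simp only [Arith.eval_cond, Arith.eval_mul, Arith.eval_lt, hsum]
  simp [Code.cand, Code.bag, hcand.eval_ld_self, hbag.eval_ld_self, h0, h1, h4, h5, hx, hy]

theorem achieves_pos :
    Achieves (fill (.addr₂ 5 3 (.var 20) (.var 21)) Code.posE) Stage.out Stage.pos := by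
  refine Stage.local_out.achieves_mat Input.posN (by decide) (by decide) (by decide)
    fun i s hs hx hy => ?_
  have h0 := Stage.local_out.reg_zero i s hs
  have hout := hs.2
  refine Arith.eval_sum_congr h0 fun j hj => ?_
  simp [Code.out, hout.eval_ld, State.setReg_reg, h0, hx, hj]

/-- The address of the list for the row `x`. -/
def Input.listAddr (i : Input) (x : ℕ) : ℕ := 6 * (i.n * i.n) + 3 * i.n + x * (i.n + 1)

theorem Code.eval_headAddr {i : Input} {s : State} (h0 : s.reg 0 = i.n) (e : Arith) :
    (Code.headAddr e).eval s = i.listAddr (e.eval s) := by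
  simp [Code.headAddr, Input.listAddr, Arith.base, h0]

namespace Stage

open Input

def items (i : Input) (s : State) : Prop := pos i s ∧
  ∀ x < i.n, ∀ y < i.n, s.mem (i.listAddr x + (1 + y)) = i.itemN x y
def heads (i : Input) (s : State) : Prop := items i s ∧
  ∀ x < i.n, s.mem (i.listAddr x) = i.headN x
def table (i : Input) (s : State) : Prop := heads i s ∧ Vec 7 4 listAddr i s

/-- The memory holds the lists of the output and the table of their addresses. -/
structure Output (i : Input) (m : ℕ → ℕ) : Prop where
  head : ∀ x < i.n, m (i.listAddr x) = i.headN x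
  item : ∀ x < i.n, ∀ y < i.n, m (i.listAddr x + (1 + y)) = i.itemN x y
  table : ∀ x < i.n, m (7 * (i.n * i.n) + 4 * i.n + x) = i.listAddr x
  zero : i.n = 0 → ∀ b, m b = 0

/-- The final states. -/
structure final (i : Input) (s : State) : Prop where
  out : Output i s.mem
  reg_zero : s.reg 0 = i.jungleN
  reg_one : s.reg 1 = if i.jungleN ≠ 0 then 6 * (i.n * i.n) + 3 * i.n else i.countN
  reg_two : s.reg 2 = 7 * (i.n * i.n) + 4 * i.n

/-- The `n (n + 1)` cells of the lists exactly fill the space up to the table of addresses. -/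
theorem head_lt_table {i : Input} {x y : ℕ} (hx : x < i.n) (hy : y ≤ i.n) :
    i.listAddr x + y < 7 * (i.n * i.n) + 4 * i.n := by
  have h1 : (x + 1) * (i.n + 1) ≤ i.n * (i.n + 1) := Nat.mul_le_mul_right _ hx
  unfold Input.listAddr
  nlinarith

/-- Relative to the start of the lists, the heads are at the multiples of `n + 1` and the items are
not. -/
theorem head_ne_item {i : Input} {x x' y : ℕ} (hy : y < i.n) :
    i.listAddr x + (1 + y) ≠ i.listAddr x' := by
  intro h
  unfold Input.listAddr at h
  have := mul_add_inj (n := i.n + 1) (x := x) (x' := x') (y := 1 + y) (y' := 0) (by omega)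
    (by omega) (by omega)
  omega

theorem local_heads : Local heads 6 7 4 := by
  refine ⟨fun i s hs => local_pos.reg_zero i s hs.1.1, fun i s s' hs hr hm hz =>
    ⟨⟨?_, fun x hx y hy => ?_⟩, fun x hx => ?_⟩⟩
  · exact local_pos.congr i s s' hs.1.1 hr (fun b hb => hm b (by omega)) hz
  · rw [hm _ (head_lt_table hx (by omega)), hs.1.2 x hx y hy]
  · rw [hm _ (by simpa using head_lt_table hx (Nat.zero_le _)), hs.2 x hx]

end Stage

theorem Achieves.mono {P : Prog} {pre post post' : Input → State → Prop} (h : Achieves P pre post)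
    (hpost : ∀ i s, post i s → post' i s) : Achieves P pre post' := by
  intro p
  obtain ⟨q, c, C, hC⟩ := h p
  refine ⟨q, c, C, fun i s hs hB M hM => ?_⟩
  obtain ⟨s', t, he, hp, hB', ht⟩ := hC i s hs hB M hM
  exact ⟨s', t, he, hpost i s' hp, hB', ht⟩

theorem achieves_items :
    Achieves (fill (Code.headAddr (.var 20) + (1 + .var 21)) Code.itemE) Stage.pos Stage.items := by
  refine achieves_fill_of_stable (fun i x y => i.listAddr x + (1 + y)) Input.itemN
    Stage.local_pos.reg_zero (fun i s s' hs hr hm => ?_) (fun i s hs => ?_)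
    (fun i x _ y hy x' _ y' hy' h => ?_) (by decide) (by decide) (by decide) (by decide)
    fun i s hs hx hy => ?_
  · refine Stage.local_pos.congr i s s' hs (fun r hr' => hr r (by omega)) (fun b hb => ?_)
      fun hz => funext fun b => hm b fun x hx => by omega
    refine hm b fun x _ y _ => ?_
    unfold Input.listAddr
    omega
  · simp [Code.eval_headAddr (Stage.local_pos.reg_zero i s hs)]
  · unfold Input.listAddr at h
    obtain ⟨rfl, h'⟩ := mul_add_inj (n := i.n + 1) (x := x) (x' := x') (y := 1 + y)
      (y' := 1 + y') (by omega) (by omega) (by omega)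
    obtain rfl : y = y' := by omega
    rfl
  · have h0 := Stage.local_pos.reg_zero i s hs
    have hout := hs.1.2
    have hpos := hs.2
    refine Arith.eval_sum_congr h0 fun j hj => ?_
    simp [Code.out, Code.pos, hout.eval_ld, hpos.eval_ld, State.setReg_reg, h0, hx, hj]

theorem achieves_heads :
    Achieves (fill (Code.headAddr (.var 21)) Code.headE) Stage.items Stage.heads := by
  refine (achieves_fill_of_stable (fun i _ y => i.listAddr y) (fun i _ y => i.headN y)
    (fun i s hs => Stage.local_pos.reg_zero i s hs.1) (fun i s s' hs hr hm => ?_)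
    (fun i s hs => ?_) (fun i x _ y hy x' _ y' hy' h => ?_) (by decide) (by decide) (by decide)
    (by decide) fun i s hs hx hy => ?_).mono fun i s hs => ⟨hs.1, fun x hx => hs.2 x hx x hx⟩
  · refine ⟨Stage.local_pos.congr i s s' hs.1 (fun r hr' => hr r (by omega)) (fun b hb => ?_)
      fun hz => funext fun b => hm b fun x hx => by omega, fun x hx y hy => ?_⟩
    · refine hm b fun x _ y _ => ?_
      unfold Input.listAddr
      omega
    · rw [hm _ fun x' _ y' _ => Stage.head_ne_item hy, hs.2 x hx y hy]
  · simp [Code.eval_headAddr (Stage.local_pos.reg_zero i s hs.1)]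
  · unfold Input.listAddr at h
    obtain ⟨rfl, -⟩ := mul_add_inj (n := i.n + 1) (x := y) (x' := y') (y := 0) (y' := 0)
      (by omega) (by omega) (by omega)
    rfl
  · have h0 := Stage.local_pos.reg_zero i s hs.1
    have hout := hs.1.1.2
    refine Arith.eval_sum_congr h0 fun j hj => ?_
    simp [Code.out, hout.eval_ld, State.setReg_reg, h0, hy, hj]

theorem achieves_table :
    Achieves (fill (.addr₁ 7 4 (.var 21)) (Code.headAddr (.var 21))) Stage.heads Stage.table :=
  Stage.local_heads.achieves_vec Input.listAddr (by decide) (by decide) (by decide)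
    fun i s hs _ _ => by simp [Code.eval_headAddr (Stage.local_heads.reg_zero i s hs)]

theorem achieves_final :
    Achieves (.seq (assign 2 (.base 7 4)) (.seq (assign 1 Code.countE) (assign 0 (.var 5))))
      Stage.table Stage.final := by
  let S₂ : Input → State → Prop := fun i s => Stage.Output i s.mem ∧ s.reg 0 = i.n ∧
    s.reg 1 = i.k ∧ s.reg 4 = i.smallN ∧ s.reg 5 = i.jungleN ∧
    s.reg 2 = 7 * (i.n * i.n) + 4 * i.n
  let S₁ : Input → State → Prop := fun i s => Stage.Output i s.mem ∧ s.reg 0 = i.n ∧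
    s.reg 5 = i.jungleN ∧ s.reg 2 = 7 * (i.n * i.n) + 4 * i.n ∧
    s.reg 1 = if i.jungleN ≠ 0 then 6 * (i.n * i.n) + 3 * i.n else i.countN
  refine .seq (mid := S₂) ?_ (.seq (mid := S₁) ?_ ?_)
  · refine achieves_assign (by decide) (by decide)
      (fun i s hs => Stage.local_heads.reg_zero i s hs.1) fun i s s' hs hm hx hr => ?_
    have h0 := Stage.local_heads.reg_zero i s hs.1
    obtain ⟨⟨⟨⟨⟨⟨⟨⟨⟨⟨⟨⟨⟨⟨⟨⟨⟨-, h1, hz⟩, -⟩, -⟩, -⟩, -⟩, -⟩, -⟩, h2⟩, h3⟩, h4⟩, h5⟩, -⟩, -⟩,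
      -⟩, hitem⟩, hhead⟩, htab⟩ := hs
    refine ⟨⟨by rw [hm]; exact hhead, by rw [hm]; exact hitem, by rw [hm]; exact htab,
      by rw [hm]; exact hz⟩, ?_, ?_, ?_, ?_, ?_⟩
    · rw [hr 0 (by omega) (by omega), h0]
    · rw [hr 1 (by omega) (by omega), h1]
    · rw [hr 4 (by omega) (by omega), h4]
    · rw [hr 5 (by omega) (by omega), h5]
    · rw [hx]; simp [Arith.base, h0]
  · refine achieves_assign (by decide) (by decide) (fun i s hs => hs.2.1)
      fun i s s' hs hm hx hr => ?_
    obtain ⟨hout, h0, h1, h4, h5, h2⟩ := hs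
    refine ⟨by rw [hm]; exact hout, ?_, ?_, ?_, ?_⟩
    · rw [hr 0 (by omega) (by omega), h0]
    · rw [hr 5 (by omega) (by omega), h5]
    · rw [hr 2 (by omega) (by omega), h2]
    · rw [hx]
      simp [Code.countE, Code.window, Code.gap, Input.countN, Input.window, Input.gap, Arith.base,
        h0, h1, h4, h5]
  · refine achieves_assign (by decide) (by decide) (fun i s hs => hs.2.1)
      fun i s s' hs hm hx hr => ?_
    obtain ⟨hout, h0, h5, h2, h1⟩ := hs
    refine ⟨by rw [hm]; exact hout, ?_, ?_, ?_⟩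
    · rw [hx]; simp [h5]
    · rw [hr 1 (by omega) (by omega), h1]
    · rw [hr 2 (by omega) (by omega), h2]

theorem achieves_algorithm : Achieves algorithm Stage.start Stage.final :=
  achieves_deg.seq <| achieves_rk.seq <| achieves_jump.seq <| achieves_low.seq <|
    achieves_bag.seq <| achieves_tangle.seq <| achieves_large.seq <| achieves_small.seq <|
    achieves_jungle.seq <| achieves_cand.seq <| achieves_out.seq <| achieves_pos.seq <|
    achieves_items.seq <| achieves_heads.seq <| achieves_table.seq achieves_final

theorem start_inputState (i : Input) : Stage.start i (inputState i.T i.k) := by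
  refine ⟨⟨rfl, rfl, fun h b => ?_⟩, fun x _ y _ => ?_⟩
  · have : ¬ ∃ u v : Fin i.n, b = (u : ℕ) * i.n + (v : ℕ) ∧ i.T.Adj u v := by
      rintro ⟨u, -⟩
      exact absurd u.isLt (by omega)
    simp [inputState, this]
  · simp [Input.adjN]

theorem exists_exec_algorithm : ∃ c C : ℕ, ∀ i : Input, ∃ (s : State) (t : ℕ),
    Exec ((i.n + i.k + 2) ^ c) algorithm (inputState i.T i.k) s t ∧ t ≤ C * (i.n + 1) ^ 3 ∧
      Stage.final i s := by
  obtain ⟨q, c, C, h⟩ := achieves_algorithm 1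
  refine ⟨c + 1, C, fun i => ?_⟩
  have hB : (inputState i.T i.k).Bdd 20 (i.size ^ 1) := by
    refine ⟨fun r _ => ?_, fun b => ?_⟩ <;> simp only [inputState, pow_one, Input.size] <;>
      split_ifs <;> omega
  -- The word bound has to be strict, hence the exponent `c + 1`.
  obtain ⟨s, t, he, hs, -, ht⟩ := h i _ (start_inputState i) hB (i.size ^ (c + 1))
    (Nat.pow_lt_pow_right (by have := i.two_le_size; omega) (by omega))
  exact ⟨s, t, he, ht, hs⟩

/-! ### Indicators and lists -/

section Indicator

theorem ind_eq_zero {p : Prop} : ind p = 0 ↔ ¬ p := by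
  unfold ind; split_ifs with h <;> simp [h]

theorem ind_of {p : Prop} (h : p) : ind p = 1 := if_pos h

theorem ind_mul (p q : Prop) : ind p * ind q = ind (p ∧ q) := by
  unfold ind; split_ifs <;> simp_all

theorem ind_congr {p q : Prop} (h : p ↔ q) : ind p = ind q := by rw [propext h]

variable {n : ℕ}

open Classical in
theorem sum_range_ind (P : Fin n → Prop) (f : ℕ → ℕ) (h : ∀ v : Fin n, f v = ind (P v)) :
    ∑ j ∈ Finset.range n, f j = (Finset.univ.filter P).card := by
  rw [Finset.sum_range, Finset.card_filter]
  refine Finset.sum_congr rfl fun v _ => ?_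
  rw [h, ind]

theorem sum_range_ind_mem (S : Finset (Fin n)) (f : ℕ → ℕ) (h : ∀ v : Fin n, f v = ind (v ∈ S)) :
    ∑ j ∈ Finset.range n, f j = S.card := by
  rw [sum_range_ind _ f h]
  congr 1
  ext v
  simp

theorem sum_range_eq_zero (P : Fin n → Prop) (f : ℕ → ℕ) (h : ∀ v : Fin n, f v = ind (P v)) :
    ∑ j ∈ Finset.range n, f j = 0 ↔ ∀ v, ¬ P v := by
  rw [Finset.sum_range, Finset.sum_eq_zero_iff]
  simp only [h, ind_eq_zero, Finset.mem_univ, true_imp_iff]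

/-- Counting the indices up to which nothing is found gives the first index of a hit. -/
theorem sum_ind_first (P : ℕ → Prop) (f : ℕ → ℕ) (h : ∀ x < n, f x = ind (P x)) :
    (∑ x ∈ Finset.range n, ind (∑ x' ∈ Finset.range n, ind (x' ≤ x) * f x' = 0) < n →
      P (∑ x ∈ Finset.range n, ind (∑ x' ∈ Finset.range n, ind (x' ≤ x) * f x' = 0))) ∧
    (n ≤ ∑ x ∈ Finset.range n, ind (∑ x' ∈ Finset.range n, ind (x' ≤ x) * f x' = 0) →
      ∀ x < n, ¬ P x) := by
  classical
  have hin : ∀ x < n, (∑ x' ∈ Finset.range n, ind (x' ≤ x) * f x' = 0 ↔ ∀ x' ≤ x, ¬ P x') := by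
    intro x hx
    rw [Finset.sum_eq_zero_iff]
    constructor
    · intro h1 x' hx' hP
      have := h1 x' (Finset.mem_range.2 (by omega))
      rw [h x' (by omega), ind_of hx', ind_of hP] at this
      omega
    · intro h1 x' hx'
      rw [h x' (Finset.mem_range.1 hx'), ind_mul, ind_eq_zero]
      exact fun h2 => h1 x' h2.1 h2.2
  have hcard : ∑ x ∈ Finset.range n, ind (∑ x' ∈ Finset.range n, ind (x' ≤ x) * f x' = 0) =
      ((Finset.range n).filter fun x => ∀ x' ≤ x, ¬ P x').card := by
    rw [Finset.card_filter]
    refine Finset.sum_congr rfl fun x hx => ?_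
    rw [ind_congr (hin x (Finset.mem_range.1 hx)), ind]
    split_ifs <;> rfl
  rw [hcard]
  by_cases hex : ∃ x, x < n ∧ P x
  · have hmin := fun {m} => Nat.find_min (H := hex) (m := m)
    obtain ⟨h1, h2⟩ := Nat.find_spec hex
    have hset : ((Finset.range n).filter fun x => ∀ x' ≤ x, ¬ P x') =
        Finset.range (Nat.find hex) := by
      ext x
      simp only [Finset.mem_filter, Finset.mem_range]
      constructor
      · rintro ⟨_, h4⟩
        by_contra hcon
        exact h4 _ (by omega) h2
      · intro hx
        exact ⟨by omega, fun x' hx' hP => hmin (m := x') (by omega) ⟨by omega, hP⟩⟩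
    rw [hset, Finset.card_range]
    exact ⟨fun _ => h2, fun h3 => by omega⟩
  · push Not at hex
    have hset : ((Finset.range n).filter fun x => ∀ x' ≤ x, ¬ P x') = Finset.range n :=
      Finset.filter_true_of_mem fun x hx x' hx' => hex x' (by have := Finset.mem_range.1 hx; omega)
    rw [hset, Finset.card_range]
    exact ⟨fun h => absurd h (lt_irrefl _), fun _ => hex⟩

/-- The number of smaller elements of `S`. -/
def indexIn (S : Finset (Fin n)) (v : Fin n) : ℕ := (S.filter fun u => u < v).card

theorem indexIn_lt {S : Finset (Fin n)} {u v : Fin n} (hu : u ∈ S) (h : u < v) :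
    indexIn S u < indexIn S v := by
  refine Finset.card_lt_card ⟨fun w hw => ?_, fun hsub => ?_⟩
  · simp only [Finset.mem_filter] at hw ⊢
    exact ⟨hw.1, hw.2.trans h⟩
  · have := @hsub u (by simp [hu, h])
    simp at this

theorem indexIn_injOn (S : Finset (Fin n)) : Set.InjOn (indexIn S) S := by
  intro u hu v hv h
  rcases lt_trichotomy u v with h1 | h1 | h1
  · have := indexIn_lt hu h1; omega
  · exact h1
  · have := indexIn_lt hv h1; omega

/-- `indexIn S` numbers the elements of `S` by `0, …, |S| - 1`. It gives the list positions and also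
selects exactly `k` candidates. -/
theorem image_indexIn (S : Finset (Fin n)) : S.image (indexIn S) = Finset.range S.card := by
  refine Finset.eq_of_subset_of_card_le (fun t ht => ?_) ?_
  · obtain ⟨v, hv, rfl⟩ := Finset.mem_image.1 ht
    refine Finset.mem_range.2 (Finset.card_lt_card ⟨Finset.filter_subset _ _, fun h => ?_⟩)
    have := h hv
    simp at this
  · rw [Finset.card_image_of_injOn (indexIn_injOn S), Finset.card_range]

theorem card_indexIn_lt {S : Finset (Fin n)} {k : ℕ} (h : k ≤ S.card) :
    (S.filter fun v => indexIn S v < k).card = k := by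
  have himg : (S.filter fun v => indexIn S v < k).image (indexIn S) = Finset.range k := by
    ext t
    simp only [Finset.mem_image, Finset.mem_filter, Finset.mem_range]
    constructor
    · rintro ⟨v, hv, rfl⟩; exact hv.2
    · intro ht
      have : t ∈ S.image (indexIn S) := by rw [image_indexIn]; exact Finset.mem_range.2 (by omega)
      obtain ⟨v, hv, rfl⟩ := Finset.mem_image.1 this
      exact ⟨v, ⟨hv, ht⟩, rfl⟩
  rw [← Finset.card_image_of_injOn ((indexIn_injOn S).mono
    (Finset.coe_subset.2 (Finset.filter_subset _ _))), himg, Finset.card_range]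

theorem listsSet_of_items {S : Finset (Fin n)} {mem : ℕ → ℕ} {a : ℕ} (hcard : mem a = S.card)
    (hitem : ∀ v ∈ S, mem (a + (1 + indexIn S v)) = v) : ListsSet mem a S := by
  refine ⟨hcard, fun v => ⟨fun hv => ⟨indexIn S v, ?_, ?_⟩, ?_⟩⟩
  · rw [← Finset.mem_range, ← image_indexIn]
    exact Finset.mem_image_of_mem _ hv
  · rw [add_assoc]; exact hitem v hv
  · rintro ⟨t, ht, hm⟩
    rw [← Finset.mem_range, ← image_indexIn] at ht
    obtain ⟨v', hv', rfl⟩ := Finset.mem_image.1 ht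
    rw [add_assoc, hitem v' hv'] at hm
    rwa [← Fin.ext hm]

theorem indexIn_lt_size (S : Finset (Fin n)) (v : Fin n) : indexIn S v < n := by
  have h1 : (S.filter fun u => u < v) ⊆ Finset.univ.erase v := fun u hu => by
    have := (Finset.mem_filter.1 hu).2
    simp [this.ne]
  have h2 := Finset.card_le_card h1
  rw [Finset.card_erase_of_mem (Finset.mem_univ v), Finset.card_univ, Fintype.card_fin] at h2
  have := v.isLt
  unfold indexIn
  omega

end Indicator

/-! ### Correctness -/

section Correctness

open Classical

namespace Input

variable (i : Input)

/-- The rank of a vertex in the order by out-degrees. -/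
noncomputable def rk (v : Fin i.n) : ℕ := rank (outdeg i.T) v

/-- The out-degrees of the vertices with the ranks `x, …, x + gap - 1` are nearly equal. -/
def Tangle (x : ℕ) : Prop := x + i.gap ≤ i.n ∧ ∀ u v : Fin i.n,
  x ≤ i.rk u → i.rk u < x + i.gap → x ≤ i.rk v → i.rk v < x + i.gap →
    outdeg i.T v < outdeg i.T u + i.k

/-- The bags of the algorithm. -/
noncomputable def bags (x : ℕ) : Finset (Fin i.n) := bag i.T i.rk i.window i.k x

/-- The set of vertices from which a jungle is chosen. -/
noncomputable def cand : Finset (Fin i.n) :=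
  if i.k < 2 then Finset.univ else
  if i.firstTangle < i.n then
    (Finset.univ.filter fun v => i.firstTangle ≤ i.rk v ∧ i.rk v < i.firstTangle + i.gap).filter
      fun v => 5 * i.k ≤ ((Finset.univ.filter fun v =>
        i.firstTangle ≤ i.rk v ∧ i.rk v < i.firstTangle + i.gap).filter
          fun u => i.T.Adj u v).card + 6
  else Finset.univ.filter fun v =>
    i.firstLarge + i.gap ≤ i.rk v ∧ i.rk v < i.firstLarge + i.gap + i.k

variable {i}

theorem adjN_eq (u v : Fin i.n) : i.adjN u v = ind (i.T.Adj u v) := by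
  unfold adjN inputState ind
  refine if_congr ⟨?_, fun h => ⟨u, v, rfl, h⟩⟩ rfl rfl
  rintro ⟨u', v', h, hadj⟩
  obtain ⟨h1, h2⟩ := mul_add_inj v.isLt v'.isLt h
  rwa [Fin.ext h1, Fin.ext h2]

theorem degN_eq (v : Fin i.n) : i.degN v = outdeg i.T v :=
  sum_range_ind _ _ fun u => adjN_eq v u

theorem rkN_eq (v : Fin i.n) : i.rkN v = i.rk v := by
  refine (sum_range_ind (fun u => outdeg i.T u < outdeg i.T v ∨
    (outdeg i.T u = outdeg i.T v ∧ u < v)) _ fun u => ?_).trans ?_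
  · rw [degN_eq, degN_eq, ind_mul, Fin.val_fin_lt]
    unfold ind
    split_ifs <;> first | rfl | omega
  · unfold rk rank
    congr

theorem inN_eq (x : ℕ) (v : Fin i.n) :
    i.inN x v = ind (x ≤ i.rk v ∧ i.rk v < x + i.gap) := by
  unfold inN
  rw [rkN_eq, ind_mul]

theorem tangleN_eq (x : ℕ) : i.tangleN x = ind (i.Tangle x) := by
  unfold tangleN
  rw [ind_mul]
  refine ind_congr (and_congr_right fun _ => ?_)
  rw [Finset.sum_range, Finset.sum_eq_zero_iff]
  simp only [Finset.mem_univ, true_imp_iff]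
  refine forall_congr' fun u => ?_
  rw [jumpN, sum_range_eq_zero (fun v => ((x ≤ i.rk u ∧ i.rk u < x + i.gap) ∧
    x ≤ i.rk v ∧ i.rk v < x + i.gap) ∧ outdeg i.T u + i.k ≤ outdeg i.T v) _ fun v => by
      rw [inN_eq, inN_eq, degN_eq, degN_eq, ind_mul, ind_mul]]
  refine forall_congr' fun v => ?_
  constructor
  · intro h h1 h2 h3 h4
    by_contra hcon
    exact h ⟨⟨⟨h1, h2⟩, h3, h4⟩, by omega⟩
  · rintro h ⟨⟨⟨h1, h2⟩, h3, h4⟩, h5⟩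
    have := h h1 h2 h3 h4
    omega

theorem lowN_eq (x : ℕ) (v : Fin i.n) : i.lowN x v = lowIndeg i.T i.rk x v := by
  refine (sum_range_ind (fun u => i.rk u < x ∧ i.T.Adj u v) _ fun u => ?_).trans ?_
  · rw [rkN_eq, adjN_eq, ind_mul]
  · unfold lowIndeg
    congr

theorem bagN_eq (x : ℕ) (v : Fin i.n) : i.bagN x v = ind (v ∈ i.bags x) := by
  have hsum := sum_range_eq_zero (fun v' => i.T.Adj v v' ∧ x + i.window ≤ i.rk v' ∧
    lowIndeg i.T i.rk x v' ≤ i.k) (fun v' => i.adjN v v' * ind (x + i.window ≤ i.rkN v') *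
      ind (i.lowN x v' ≤ i.k)) fun v' => by
        rw [adjN_eq, rkN_eq, lowN_eq, ind_mul, ind_mul, and_assoc]
  unfold bagN
  rw [rkN_eq, lowN_eq, ind_mul, ind_mul]
  refine ind_congr ?_
  -- The sum of indicators is positive exactly if one of the three rules holds; the inner sum counts
  -- the witnesses of the third.
  rw [Nat.pos_iff_ne_zero, Ne, Nat.add_eq_zero_iff, Nat.add_eq_zero_iff, Nat.mul_eq_zero, hsum,
    ind_eq_zero, ind_eq_zero, ind_eq_zero, ← not_exists]
  simp only [bags, bag, Finset.mem_filter, Finset.mem_univ, true_and]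
  generalize (x ≤ i.rk v ∧ i.rk v ≤ x + i.window) = p
  generalize (x + i.window ≤ i.rk v ∧ i.k ≤ lowIndeg i.T i.rk x v) = q
  generalize (∃ v', i.T.Adj v v' ∧ x + i.window ≤ i.rk v' ∧ lowIndeg i.T i.rk x v' ≤ i.k) = r
  generalize (i.rk v < x) = r'
  tauto

theorem largeN_eq (x : ℕ) :
    i.largeN x = ind (x + i.window < i.n ∧ i.cap < (i.bags x).card) := by
  unfold largeN
  rw [ind_mul, sum_range_ind_mem _ _ fun v => bagN_eq x v]

theorem firstTangle_spec : (i.firstTangle < i.n → i.Tangle i.firstTangle) ∧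
    (i.n ≤ i.firstTangle → ∀ x < i.n, ¬ i.Tangle x) :=
  sum_ind_first _ _ fun x _ => tangleN_eq x

theorem firstLarge_spec :
    (i.firstLarge < i.n → i.firstLarge + i.window < i.n ∧ i.cap < (i.bags i.firstLarge).card) ∧
    (i.n ≤ i.firstLarge → ∀ x < i.n, ¬ (x + i.window < i.n ∧ i.cap < (i.bags x).card)) :=
  sum_ind_first _ _ fun x _ => largeN_eq x

theorem candN_eq (v : Fin i.n) : i.candN v = ind (v ∈ i.cand) := by
  unfold candN cand
  simp only [ne_eq, ind_eq_zero, not_not]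
  split_ifs with h1 h2
  · simp [ind_of]
  · rw [inN_eq, ind_mul, sum_range_ind (fun u => (i.firstTangle ≤ i.rk u ∧
      i.rk u < i.firstTangle + i.gap) ∧ i.T.Adj u v) _ fun u => by rw [inN_eq, adjN_eq, ind_mul]]
    refine ind_congr ?_
    rw [Finset.mem_filter, Finset.filter_filter]
    simp only [Finset.mem_filter, Finset.mem_univ, true_and]
    refine and_congr_right fun _ => ?_
    convert Iff.rfl
  · rw [rkN_eq, ind_mul]
    simp

variable (i) in
/-- The sets in the output. -/
noncomputable def outSet (x : ℕ) : Finset (Fin i.n) :=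
  if i.jungleN ≠ 0 then i.cand.filter fun v => indexIn i.cand v < i.k else
  if i.smallN ≠ 0 then Finset.univ else i.bags x

theorem sum_before (S : Finset (Fin i.n)) (f : ℕ → ℕ) (h : ∀ v : Fin i.n, f v = ind (v ∈ S))
    (v : Fin i.n) : ∑ v' ∈ Finset.range i.n, ind (v' < v) * f v' = indexIn S v := by
  refine (sum_range_ind (fun v' => v' ∈ S ∧ v' < v) _ fun v' => ?_).trans ?_
  · rw [h, ind_mul, Fin.val_fin_lt]
    exact ind_congr and_comm
  · unfold indexIn
    congr 1
    ext u
    simp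

theorem outN_eq (x : ℕ) (v : Fin i.n) : i.outN x v = ind (v ∈ i.outSet x) := by
  unfold outN outSet
  split_ifs with h1 h2
  · rw [sum_before i.cand _ candN_eq, candN_eq, ind_mul]
    simp
  · simp [ind_of]
  · exact bagN_eq x v

theorem posN_eq (x : ℕ) (v : Fin i.n) : i.posN x v = indexIn (i.outSet x) v :=
  sum_before _ _ (outN_eq x) v

theorem headN_eq (x : ℕ) : i.headN x = (i.outSet x).card := by
  exact sum_range_ind_mem _ _ fun v => outN_eq x v

/-- The sum inverts the numbering: only the element at the given position contributes. -/
theorem itemN_eq (x : ℕ) {v : Fin i.n} (hv : v ∈ i.outSet x) :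
    i.itemN x (indexIn (i.outSet x) v) = v := by
  unfold itemN
  rw [Finset.sum_range, Finset.sum_eq_single v]
  · rw [posN_eq, outN_eq, ind_of hv, ind_of rfl]
    simp
  · intro u _ hu
    rw [outN_eq, posN_eq, ind_mul, ind_eq_zero.2, mul_zero]
    rintro ⟨h1, h2⟩
    exact hu (indexIn_injOn _ h1 hv h2)
  · simp

theorem listsSet_of_output {m : ℕ → ℕ} (h : Stage.Output i m) {x : ℕ} (hx : x < i.n) :
    ListsSet m (i.listAddr x) (i.outSet x) :=
  listsSet_of_items (by rw [h.head x hx, headN_eq]) fun v hv => by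
    rw [h.item x hx _ (indexIn_lt_size _ v), itemN_eq x hv]


/-! ### Jungles from equal out-degrees or large bags -/

theorem le_of_rk_le {u v : Fin i.n} (h : i.rk u ≤ i.rk v) : outdeg i.T u ≤ outdeg i.T v :=
  le_of_rank_le h

/-- If there is no window of nearly equal out-degrees, then a vertex is linked to the vertices
whose rank is smaller by `gap`. -/
theorem linked_of_rk (hT : IsSemicomplete i.T) (h : ∀ x < i.n, ¬ i.Tangle x) {u z : Fin i.n}
    (huz : i.rk u + i.gap ≤ i.rk z) : Linked i.T i.k z u := by
  have hz : i.rk z < i.n := rank_lt _ z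
  -- The window that starts at `u` has a jump from `a` to `b`. Since `a` ranks at least as high as
  -- `u`, and `b` below `z`, the out-degrees of `u` and `z` differ by at least `k`.
  have hu := h (i.rk u) (by omega)
  have hlt : i.rk u + i.gap ≤ i.n := by omega
  simp only [Tangle, hlt, true_and] at hu
  push Not at hu
  obtain ⟨a, b, h1, h2, h3, h4, h5⟩ := hu
  have h6 := le_of_rk_le (i := i) h1
  have h7 := le_of_rk_le (i := i) (u := b) (v := z) (by omega)
  exact linked_of_outdeg_add_le hT (by omega)

/-- Window and cover together have at most `k ^ 2 + 23k - 26` vertices, and `3k ^ 2 - 16k + 27` has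
no real zero. -/
theorem window_le_cap (hk : 2 ≤ i.k) : i.window + 1 + (i.k + 1) * i.k ≤ i.cap + (i.k + 1) := by
  unfold window gap cap
  obtain ⟨m, hm⟩ : ∃ m, i.k = m + 2 := ⟨i.k - 2, by omega⟩
  have h1 : 2 * (11 * i.k - 13) = 22 * m + 18 := by omega
  rw [h1, hm]
  rcases Nat.lt_or_ge m 3 with h | h
  · interval_cases m <;> norm_num
  · nlinarith

theorem cand_spec (hT : IsSemicomplete i.T) (h : i.jungleN ≠ 0) :
    i.k ≤ i.cand.card ∧ (2 ≤ i.k → ∀ x ∈ i.cand, ∀ y ∈ i.cand, Linked i.T i.k x y) := by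
  have hsmall : ¬ i.n ≤ i.cap := by
    intro hs
    apply h
    unfold jungleN smallN
    rw [if_pos (by rw [ind_of hs]; omega)]
  unfold cand
  split_ifs with h1 h2
  · refine ⟨?_, fun h3 => by omega⟩
    rw [Finset.card_univ, Fintype.card_fin]
    unfold cap at hsmall
    omega
  · obtain ⟨h3, h4⟩ := firstTangle_spec.1 h2
    have hcard := card_rank_window (outdeg i.T) h3
    refine ⟨le_card_large_indeg hT (by omega) (by
      refine le_trans ?_ hcard.ge
      exact le_rfl), fun hk x hx y hy => ?_⟩
    refine linked_of_indeg hT hk (fun u hu v hv => ?_) (Finset.mem_filter.1 hx).1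
      (Finset.mem_filter.1 hy).1 (Finset.mem_filter.1 hy).2
    simp only [Finset.mem_filter, Finset.mem_univ, true_and] at hu hv
    exact h4 u v hu.1 hu.2 hv.1 hv.2
  · have hlarge : i.firstLarge < i.n := by
      by_contra hcon
      apply h
      unfold jungleN
      rw [if_neg, if_neg, if_neg, ind_eq_zero]
      · exact hcon
      · rw [not_not, ind_eq_zero]; exact h2
      · rw [not_not, ind_eq_zero]; exact h1
      · rw [not_not, smallN, ind_eq_zero]; exact hsmall
    obtain ⟨h3, h4⟩ := firstLarge_spec.1 hlarge
    have hno := firstTangle_spec.2 (not_lt.1 h2)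
    -- The middle `k` ranks of the window are at distance at least `gap` from both sides of the cut,
    -- so `linked_of_rk` applies in both directions.
    have hw : i.window = 2 * i.gap + i.k := rfl
    refine ⟨(card_rank_window (outdeg i.T) (i := i.firstLarge + i.gap) (l := i.k) (by omega)).ge,
      fun hk x hx y hy => ?_⟩
    simp only [Finset.mem_filter, Finset.mem_univ, true_and] at hx hy
    have hcap := window_le_cap hk
    refine linked_of_card_bag (rk := i.rk) i.window i.k (rank_injective _) (i := i.firstLarge)
      (fun u hu => linked_of_rk hT hno ?_) (fun v hv => linked_of_rk hT hno ?_) ?_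
    · have : i.rk u < i.firstLarge := hu
      omega
    · have : i.firstLarge + i.window ≤ i.rk v := hv
      omega
    · have : i.cap < (bag i.T i.rk i.window i.k i.firstLarge).card := h4
      omega

theorem linked_self {V : Type*} [Fintype V] [DecidableEq V] (T : Digraph V) (k : ℕ) (x : V) :
    Linked T k x x := by
  rintro ⟨j, A, B, -, -, h1, h2⟩
  rw [Finset.mem_sdiff] at h1 h2
  exact h1.2 h2.1

theorem isJungle_outSet (hT : IsSemicomplete i.T) (h : i.jungleN ≠ 0) (x : ℕ) :
    IsJungle i.T i.k (i.outSet x) := by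
  obtain ⟨h1, h2⟩ := cand_spec hT h
  unfold outSet
  rw [if_pos h]
  have hcard := card_indexIn_lt h1
  refine ⟨hcard, fun x hx y hy => ?_⟩
  by_cases hk : 2 ≤ i.k
  · exact h2 hk x (Finset.mem_filter.1 hx).1 y (Finset.mem_filter.1 hy).1
  -- For `k ≤ 1` the set has at most one element, and no vertex is separated from itself.
  · obtain rfl : x = y := Finset.card_le_one.1 (by omega) x hx y hy
    exact linked_self _ _ x

theorem width_le {V : Type*} {r : ℕ} {W : Fin r → Finset V} (h : ∀ j, (W j).card ≤ i.cap) :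
    width W ≤ 4 * (i.k : ℤ) ^ 2 + 7 * i.k := by
  have h1 : (Finset.univ.sup fun j => (W j).card) ≤ i.cap := Finset.sup_le fun j _ => h j
  have h2 : ((Finset.univ.sup fun j => (W j).card : ℕ) : ℤ) ≤ (i.cap : ℕ) := by exact_mod_cast h1
  unfold cap at h2
  push_cast at h2
  unfold width
  nlinarith

theorem exists_output (hT : IsSemicomplete i.T) {s : State} (hs : Stage.final i s) :
    (∃ (r : ℕ) (W : Fin r → Finset (Fin i.n)), IsPathDecomposition i.T W ∧
      width W ≤ 4 * (i.k : ℤ) ^ 2 + 7 * i.k ∧ OutputsBags s W) ∨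
    ∃ Z : Finset (Fin i.n), IsJungle i.T i.k Z ∧ OutputsSet s Z := by
  obtain ⟨hout, hr0, hr1, hr2⟩ := hs
  by_cases hsmall : i.n ≤ i.cap
  · left
    have hs : i.smallN ≠ 0 := by rw [smallN, ind_of hsmall]; omega
    have hj : i.jungleN = 0 := by unfold jungleN; rw [if_pos hs]
    rw [hj] at hr0 hr1
    have hset : i.outSet 0 = Finset.univ := by
      unfold outSet; rw [if_neg (by simp [hj]), if_pos hs]
    refine ⟨1, fun _ => Finset.univ, ⟨one_pos, fun v => ⟨0, Finset.mem_univ v⟩, ?_, ?_⟩,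
      width_le fun j => ?_, hr0, ?_, fun j => ?_⟩
    · intro a b c _ _ v _; exact Finset.mem_univ v
    · intro u v _; exact Or.inl ⟨0, Finset.mem_univ u, Finset.mem_univ v⟩
    · simpa using hsmall
    · rw [hr1]; simp [countN, hs]
    · obtain rfl : j = 0 := Subsingleton.elim _ _
      rcases Nat.eq_zero_or_pos i.n with hn | hn
      -- With no vertices the table was not filled, but every cell is `0` and so any address lists
      -- the empty set.
      · refine ⟨?_, fun v => absurd v.isLt (by omega)⟩
        rw [hout.zero hn, Finset.card_univ, Fintype.card_fin, hn]
      · rw [← hset, hr2]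
        have := hout.table 0 hn
        simp only [Fin.val_zero, this]
        exact listsSet_of_output hout hn
  have hs : ¬ i.smallN ≠ 0 := by rw [smallN]; simpa [ind_eq_zero] using hsmall
  have hn : 0 < i.n := by omega
  by_cases hj : i.jungleN = 0
  · left
    have hk : 2 ≤ i.k := by
      by_contra hk
      unfold jungleN at hj
      rw [if_neg hs, if_pos (by rw [ind_of (show i.k < 2 by omega)]; omega)] at hj
      omega
    have hlarge : ¬ i.firstLarge < i.n := by
      intro hl
      unfold jungleN at hj
      rw [if_neg hs, if_neg (by rw [not_not, ind_eq_zero]; omega)] at hj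
      split_ifs at hj
      rw [ind_eq_zero] at hj
      exact hj hl
    have hno := firstLarge_spec.2 (not_lt.1 hlarge)
    -- More than `cap` vertices leave room for at least one cut.
    have hw : i.window < i.n := by
      have h1 := window_le_cap hk
      have h2 : i.k + 1 ≤ (i.k + 1) * i.k := by nlinarith
      omega
    have hbag : ∀ x, i.outSet x = i.bags x := fun x => by
      unfold outSet; rw [if_neg (by simp [hj]), if_neg hs]
    rw [hj] at hr0 hr1
    refine ⟨i.n - i.window, fun j => i.bags j,
      isPathDecomposition_bag i.T i.window i.k (rank_injective _) (rank_lt _) hw,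
      width_le fun j => ?_, hr0, ?_, fun j => ?_⟩
    · by_contra hcon
      exact hno j (by omega) ⟨by omega, by omega⟩
    · rw [hr1]; simpa [countN] using fun h => absurd h hs
    · have := listsSet_of_output hout (x := j) (by omega)
      rw [hbag] at this
      rwa [hr2, hout.table j (by omega)]
  · right
    have hone : i.jungleN = 1 := by
      unfold jungleN at hj ⊢
      split_ifs at hj ⊢ <;> simp_all [ind]
    refine ⟨i.outSet 0, isJungle_outSet hT hj 0, by rw [hr0, hone], ?_⟩
    have := listsSet_of_output hout hn
    rw [hr1, if_pos hj]
    simpa [listAddr] using this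

end Input

end Correctness

end SemicompletePathwidth

/-! ### The theorem and its time bound -/

open SemicompletePathwidth in
theorem theorem1 :
    ∃ (P : Prog) (c C : ℕ), ∀ (n : ℕ) (T : Digraph (Fin n)), IsSemicomplete T → ∀ k : ℕ,
      ∃ (s : State) (t : ℕ),
        Exec ((n + k + 2) ^ c) P (inputState T k) s t ∧
        (t : ℝ) ≤ C * (2 : ℝ) ^ ((C : ℝ) * ((k : ℝ) * Real.log k)) *
          ((max n 2 : ℕ) : ℝ) ^ 3 * Real.log ((max n 2 : ℕ) : ℝ) ∧
        ((∃ (r : ℕ) (W : Fin r → Finset (Fin n)),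
            IsPathDecomposition T W ∧ width W ≤ 4 * (k : ℤ) ^ 2 + 7 * k ∧ OutputsBags s W) ∨
          ∃ Z : Finset (Fin n), IsJungle T k Z ∧ OutputsSet s Z) := by
  obtain ⟨c, C, h⟩ := exists_exec_algorithm
  refine ⟨algorithm, c, 16 * C, fun n T hT k => ?_⟩
  obtain ⟨s, t, he, ht, hs⟩ := h ⟨n, k, T⟩
  refine ⟨s, t, he, ?_, Input.exists_output (i := ⟨n, k, T⟩) hT hs⟩
  set m : ℕ := max n 2 with hm
  have hm2 : 2 ≤ m := le_max_right _ _
  have hnm : n + 1 ≤ 2 * m := by omega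
  -- The factor `8` is from `(n + 1) ^ 3 ≤ (2m) ^ 3`; another factor `2` makes up for `log m ≥ 1 /
  -- 2`. This gives the constant `16 C`.
  have htm : (t : ℝ) ≤ 8 * C * (m : ℝ) ^ 3 := by
    have h1 : C * (n + 1) ^ 3 ≤ C * (2 * m) ^ 3 :=
      Nat.mul_le_mul_left _ (Nat.pow_le_pow_left hnm 3)
    have h2 : (t : ℝ) ≤ ((C * (2 * m) ^ 3 : ℕ) : ℝ) := by exact_mod_cast ht.trans h1
    refine h2.trans (le_of_eq ?_)
    push_cast
    ring
  have hlog : (1 / 2 : ℝ) ≤ Real.log m := by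
    have h1 : Real.log 2 ≤ Real.log m := Real.log_le_log (by norm_num) (by exact_mod_cast hm2)
    have := Real.log_two_gt_d9
    linarith
  -- The running time does not depend on `k`, so the exponential factor only has to be at least `1`.
  have hpow : (1 : ℝ) ≤ (2 : ℝ) ^ (((16 * C : ℕ) : ℝ) * ((k : ℝ) * Real.log k)) := by
    refine Real.one_le_rpow (by norm_num) (mul_nonneg (Nat.cast_nonneg _)
      (mul_nonneg (Nat.cast_nonneg _) (Real.log_natCast_nonneg k)))
  have hX : (0 : ℝ) ≤ 16 * C * (m : ℝ) ^ 3 := by positivity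
  calc (t : ℝ) ≤ 16 * C * (m : ℝ) ^ 3 * (1 / 2) := by linarith
    _ ≤ 16 * C * (m : ℝ) ^ 3 * Real.log m := mul_le_mul_of_nonneg_left hlog hX
    _ ≤ 16 * C * (m : ℝ) ^ 3 * Real.log m *
        (2 : ℝ) ^ (((16 * C : ℕ) : ℝ) * ((k : ℝ) * Real.log k)) :=
      le_mul_of_one_le_right (mul_nonneg hX (by linarith)) hpow
    _ = _ := by push_cast; ring
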